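/- Let $l$ be a prime with $l \equiv 11 \pmod{12}$, let $\Gamma_0(l^2)$ be viewed as a subgroup of $\mathrm{PSL}_2(\mathbb{Z})$, let $C = \mathbb{P}^1(\mathbb{Q}) \smallsetminus \Gamma_0(l^2)\cdot\{\infty\}$, and let $\Delta_C^0$ be the group of degree zero divisors on $\mathbb{P}^1(\mathbb{Q})$ supported on $C$. For $\gamma \in \mathrm{PSL}_2(\mathbb{Z})$, the unimodular path $e_\gamma$ is the oriented geodesic in the upper half plane from $\gamma\cdot 0$ to $\gamma\cdot\infty$; it has the divisor $\{\gamma\cdot\infty\} - \{\gamma\cdot 0\}$, by which it is also denoted. Let $\mathcal{F}$ be a fundamental domain for $\Gamma_0(l^2)$ (the closure of its interior, with connected interior, whose translates cover the upper half plane and have pairwise disjoint interiors) that is contained in the strip $0 \le \mathrm{Re}(z) \le 1$ and whose boundary $\partial\mathcal{F}$ is a union of unimodular paths; in particular its vertices are cusps. Orient $\partial\mathcal{F}$ clockwise, so that $\mathcal{F}$ lies on the right of each boundary path, and suppose that the oriented unimodular paths in $\partial\mathcal{F}$ are, without repetition, $$e_\infty,\ e_\infty^*,\ e_1,\ e_1^*,\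 \dots,\ e_t,\ e_t^*,$$ where $e_\infty = \{1\}-\{\infty\}$, $e_\infty^* = \{\infty\}-\{0\}$, and for each $i$ the path $e_i$ with reversed orientation is a $\Gamma_0(l^2)$-translate of $e_i^*$. Then $e_1, \dots, e_t$ (more precisely, their divisors) lie in $\Delta_C^0$ and form a basis of $\Delta_C^0$ as a module over $\mathbb{Z}[\Gamma_0(l^2)]$; in particular this module is free. Consequently, let $p \neq l$ be a prime, $m \ge 1$, and let $\Gamma \subset \Gamma_0(l^2p^m)$ be a subgroup of finite index in $\mathrm{PSL}_2(\mathbb{Z})$. Let $s = [\Gamma_0(l^2):\Gamma]$ and $\Gamma_0(l^2) = \bigsqcup_{j=1}^{s}\Gamma r_j$. For every abelian group $V$ with a right action of $\Gamma$ by automorphisms, written $v \mapsto v|_\gamma$, let $\mathrm{Symb}_{\Gamma,C}(V)$ be the group of homomorphisms $\varphi:\Delta_C^0 \to V$ with $\varphi(\gamma x)|_\gamma = \varphi(x)$ for all $\gamma\in\Gamma$ and $x\in\Delta_C^0$. Then $$\mathrm{Symb}_{\Gamma,C}(V) \longrightarrow V^{\oplus st}, \qquad \varphi \longmapsto \big(\varphi(r_j\cdot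 e_i)\big)_{1\le j\le s,\ 1\le i\le t}$$ is an isomorphism of abelian groups. -/

import Mathlib

open scoped MatrixGroups UpperHalfPlane OnePoint Topology

noncomputable section

namespace PartialSymbols

/-! ### The group `PSL₂(ℤ)` and its actions on `ℙ¹(ℚ)` and on `ℍ` -/

/-- The projective line over `ℚ`, i.e. the set of cusps. -/
abbrev P1Q : Type := OnePoint ℚ

/-- The action of `SL₂(ℤ)` on `ℙ¹(ℚ)` by linear fractional transformations. -/
def permP1QSL : SL(2, ℤ) →* Equiv.Perm P1Q :=
  (MulAction.toPermHom (GL (Fin 2) ℚ) P1Q).comp (Matrix.SpecialLinearGroup.mapGL ℚ)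

/-- The action of `SL₂(ℤ)` on the upper half plane by linear fractional transformations. -/
def permHSL : SL(2, ℤ) →* Equiv.Perm ℍ :=
  MulAction.toPermHom SL(2, ℤ) ℍ

theorem center_cases {g : SL(2, ℤ)} (hg : g ∈ Subgroup.center SL(2, ℤ)) : g = 1 ∨ g = -1 := by
  obtain ⟨r, hr, h⟩ := Matrix.SpecialLinearGroup.mem_center_iff.mp hg
  have hr2 : r ^ 2 = 1 := by simpa using hr
  rcases Int.isUnit_iff.mp (IsUnit.of_pow_eq_one hr2 two_ne_zero) with rfl | rfl
  · left; apply Subtype.ext; rw [← h]; simp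
  · right; apply Subtype.ext; rw [← h]; ext i j; fin_cases i <;> fin_cases j <;> simp

theorem center_le_ker_permP1QSL : Subgroup.center SL(2, ℤ) ≤ permP1QSL.ker := by
  intro g hg
  rw [MonoidHom.mem_ker]
  rcases center_cases hg with rfl | rfl
  · exact map_one _
  · ext x : 1
    change (Matrix.SpecialLinearGroup.mapGL ℚ (-1 : SL(2, ℤ))) • x = x
    induction x using OnePoint.rec with
    | infty => simp [OnePoint.smul_infty_eq_ite]
    | coe x => simp [OnePoint.smul_some_eq_ite]

theorem center_le_ker_permHSL : Subgroup.center SL(2, ℤ) ≤ permHSL.ker := by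
  intro g hg
  rw [MonoidHom.mem_ker]
  rcases center_cases hg with rfl | rfl
  · exact map_one _
  · ext x : 1
    change (-1 : SL(2, ℤ)) • x = x
    rw [ModularGroup.SL_neg_smul, one_smul]

instance : MulAction PSL(2, ℤ) P1Q :=
  MulAction.compHom _ (QuotientGroup.lift _ permP1QSL center_le_ker_permP1QSL)

instance : MulAction PSL(2, ℤ) ℍ :=
  MulAction.compHom _ (QuotientGroup.lift _ permHSL center_le_ker_permHSL)

/-- The class in `PSL₂(ℤ)` of a matrix in `SL₂(ℤ)`. -/
def toPSL : SL(2, ℤ) →* PSL(2, ℤ) :=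
  QuotientGroup.mk' _

/-- `Γ₀(N)` as a subgroup of `PSL₂(ℤ)`. -/
def PGamma0 (N : ℕ) : Subgroup PSL(2, ℤ) :=
  (CongruenceSubgroup.Gamma0 N).map toPSL

theorem PGamma0_mul_le (N M : ℕ) : PGamma0 (N * M) ≤ PGamma0 N := by
  refine Subgroup.map_mono fun A hA => ?_
  rw [CongruenceSubgroup.Gamma0_mem, ZMod.intCast_zmod_eq_zero_iff_dvd] at hA ⊢
  exact (Int.natCast_dvd_natCast.mpr (dvd_mul_right N M)).trans hA

/-! ### Divisors on cusps -/

/-- The action of `PSL₂(ℤ)` on the group of divisors on `ℙ¹(ℚ)`. -/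
def divRep : Representation ℤ PSL(2, ℤ) (P1Q →₀ ℤ) where
  toFun γ := Finsupp.lmapDomain ℤ ℤ (γ • ·)
  map_one' := by ext; simp
  map_mul' x y := by ext; simp [mul_smul]

/-- `Δ⁰_C`: the divisors on `ℙ¹(ℚ)` that are supported on `C` and have degree zero. -/
def degZeroDiv (C : Set P1Q) : Submodule ℤ (P1Q →₀ ℤ) :=
  Finsupp.supported ℤ ℤ C ⊓ LinearMap.ker (Finsupp.linearCombination ℤ fun _ : P1Q => (1 : ℤ))

/-- The set of cusps `C` is stable under `Γ`. -/
def IsInvariant (Γ : Subgroup PSL(2, ℤ)) (C : Set P1Q) : Prop :=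
  ∀ γ ∈ Γ, ∀ c ∈ C, γ • c ∈ C

theorem IsInvariant.mono {Γ Γ' : Subgroup PSL(2, ℤ)} {C : Set P1Q} (h : IsInvariant Γ C)
    (hle : Γ' ≤ Γ) : IsInvariant Γ' C :=
  fun γ hγ => h γ (hle hγ)

theorem degZeroDiv_le_comap {Γ : Subgroup PSL(2, ℤ)} {C : Set P1Q} (hC : IsInvariant Γ C)
    (γ : Γ) : degZeroDiv C ≤ (degZeroDiv C).comap (divRep γ) := by
  rintro x ⟨hx, hx'⟩
  refine ⟨?_, ?_⟩
  · rw [SetLike.mem_coe, Finsupp.mem_supported] at hx ⊢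
    intro y hy
    classical
    obtain ⟨c, hc, rfl⟩ := Finset.mem_image.mp (Finsupp.mapDomain_support hy)
    exact hC γ γ.2 c (hx hc)
  · rw [SetLike.mem_coe, LinearMap.mem_ker] at hx' ⊢
    rw [← hx']
    exact Finsupp.linearCombination_mapDomain ℤ _ _

/-- The action of `Γ` on `Δ⁰_C`, for a `Γ`-stable set of cusps `C`. The associated module over the
group ring `ℤ[Γ]` is `(degZeroRep hC).asModule`. -/
def degZeroRep {Γ : Subgroup PSL(2, ℤ)} {C : Set P1Q} (hC : IsInvariant Γ C) :
    Representation ℤ Γ (degZeroDiv C) :=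
  Representation.subrepresentation (divRep.comp Γ.subtype) (degZeroDiv C) (degZeroDiv_le_comap hC)

/-- The set of cusps `ℙ¹(ℚ) - Γ₀(N)·∞`. -/
def cuspsAway (N : ℕ) : Set P1Q :=
  (MulAction.orbit (PGamma0 N) (∞ : P1Q))ᶜ

theorem isInvariant_cuspsAway (N : ℕ) : IsInvariant (PGamma0 N) (cuspsAway N) := by
  intro γ hγ c hc h
  obtain ⟨δ, hδ⟩ := h
  refine hc ⟨⟨γ, hγ⟩⁻¹ * δ, ?_⟩
  change (⟨γ, hγ⟩⁻¹ * δ : PGamma0 N) • (∞ : P1Q) = c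
  rw [mul_smul, inv_smul_eq_iff]
  exact hδ

/-- `Symb_{Γ, C}(V)`: the partial modular symbols supported on `C` with values in a right
`Γ`-module `V`, i.e. the homomorphisms `φ : Δ⁰_C → V` with `φ(γ x)|γ = φ(x)`. The right action
`v|γ` is `MulOpposite.op γ • v`. -/
def Symb {Γ : Subgroup PSL(2, ℤ)} {C : Set P1Q} (hC : IsInvariant Γ C) (V : Type*)
    [AddCommGroup V] [DistribMulAction (↥Γ)ᵐᵒᵖ V] : AddSubgroup (degZeroDiv C →+ V) where
  carrier := {φ | ∀ (γ : Γ) (x : degZeroDiv C), MulOpposite.op γ • φ (degZeroRep hC γ x) = φ x}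
  zero_mem' := by intro γ x; simp
  add_mem' := by
    intro φ ψ hφ hψ γ x
    simp [smul_add, hφ γ x, hψ γ x]
  neg_mem' := by
    intro φ hφ γ x
    simp [smul_neg, hφ γ x]

/-! ### Unimodular paths

The oriented unimodular path `e_γ` given by `γ ∈ PSL₂(ℤ)` is the geodesic from `γ·0` to `γ·∞`,
the image under `γ` of the imaginary axis oriented upwards. Since only `1 ∈ PSL₂(ℤ)` fixes both `0`
and `∞`, oriented unimodular paths are in bijection with the elements of `PSL₂(ℤ)`; the action of
`PSL₂(ℤ)` on paths is left multiplication. -/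

/-- The divisor `{γ·∞} - {γ·0}` of the oriented unimodular path `e_γ`. -/
def pathDiv (γ : PSL(2, ℤ)) : P1Q →₀ ℤ :=
  Finsupp.single (γ • (∞ : P1Q)) 1 - Finsupp.single (γ • ((0 : ℚ) : P1Q)) 1

/-- The points in `ℍ` of the unimodular path `e_γ`. -/
def pathSet (γ : PSL(2, ℤ)) : Set ℍ :=
  (γ • ·) '' {z : ℍ | z.re = 0}

/-- The open half plane on the right of the oriented unimodular path `e_γ`. -/
def rightSide (γ : PSL(2, ℤ)) : Set ℍ :=
  (γ • ·) '' {z : ℍ | 0 < z.re}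

/-- The path `e_γ` with the opposite orientation. -/
def pathReverse (γ : PSL(2, ℤ)) : PSL(2, ℤ) :=
  γ * toPSL ModularGroup.S

/-- The vertical path `{1} - {∞}`, from `∞` down to `1`, given by the matrix with rows `(1, -1)` and
`(1, 0)`. -/
def pathInfty : PSL(2, ℤ) :=
  toPSL (ModularGroup.T * ModularGroup.S)

/-- The vertical path `{∞} - {0}`, from `0` up to `∞`. -/
def pathInftyStar : PSL(2, ℤ) :=
  1

/-! ### Fundamental domains bounded by unimodular paths -/

/-- `F ⊆ ℍ` is a fundamental domain for `Γ` contained in the strip `0 ≤ Re z ≤ 1` and bounded by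
unimodular paths. It is described by its trace on `ℍ`; the corresponding subset of
`ℍ ∪ ℙ¹(ℚ)` also contains the vertices of `F`, which are the end points of the unimodular paths
in the boundary, so that all vertices are cusps. -/
structure IsUnimodularDomain (Γ : Subgroup PSL(2, ℤ)) (F : Set ℍ) : Prop where
  /-- `F` is the closure of its interior, in particular it is closed -/
  closure_interior : closure (interior F) = F
  /-- the interior of `F` is connected -/
  isConnected_interior : IsConnected (interior F)
  /-- the translates of `F` cover the upper half plane -/
  exists_smul_mem : ∀ z : ℍ, ∃ γ ∈ Γ, γ • z ∈ F
  /-- distinct translates of `F` have disjoint interiors -/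
  disjoint_interior : ∀ γ ∈ Γ, γ ≠ 1 → Disjoint ((γ • ·) '' interior F) (interior F)
  /-- `F` lies in the vertical strip -/
  re_mem : ∀ z ∈ F, 0 ≤ z.re ∧ z.re ≤ 1
  /-- the boundary of `F` is a union of unimodular paths -/
  frontier_eq : ∃ S : Set PSL(2, ℤ), frontier F = ⋃ γ ∈ S, pathSet γ

/-- The oriented unimodular paths in the boundary `∂F`, where `∂F` is oriented clockwise, i.e. such
that `F` lies on the right of each path: near each point of the path `e_γ`, all points on the right
of `e_γ` belong to `F`. -/
def orientedBoundary (F : Set ℍ) : Set PSL(2, ℤ) :=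
  {γ | pathSet γ ⊆ frontier F ∧ ∀ z ∈ pathSet γ, F ∈ 𝓝[rightSide γ] z}

/-- `e_∞, e_∞^*, e_1, e_1^*, …, e_t, e_t^*` is an enumeration without repetition of the oriented
paths in `∂F`, where `e_∞ = {1} - {∞}`, `e_∞^* = {∞} - {0}`, and where the reversal of `e_i` is
`Γ`-equivalent to `e_i^*` (for `e_∞` and `e_∞^*` this holds by translation by `1`). -/
structure IsBoundaryEnumeration (Γ : Subgroup PSL(2, ℤ)) (F : Set ℍ) {t : ℕ}
    (e e' : Fin t → PSL(2, ℤ)) : Prop where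
  injective : Function.Injective (Sum.elim (Sum.elim e e') ![pathInfty, pathInftyStar])
  range_eq : Set.range (Sum.elim (Sum.elim e e') ![pathInfty, pathInftyStar]) = orientedBoundary F
  reverse_eq : ∀ i, ∃ γ ∈ Γ, pathReverse (e i) = γ * e' i

end PartialSymbols

end

noncomputable section

namespace PartialSymbols

/-! The unimodular paths are the edges of the Farey tessellation. They do not cross, because `n (n +
1) ≥ 0` for every integer `n` (`mul_nonneg_of_det`). Hence each open Farey triangle lies inside `F`
or misses it, and apart from its two vertical sides the boundary of `F` consists of half circles
with ends `q < p` in `[0, 1]`, with `F` outside them (`exists_isClockwiseArc`). The theorem follows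
once the translates `γ e_i` are known to form a `ℤ`-basis of `Δ⁰_C` (`exists_basis`).

Independence: let the reversal of `e_i` be `g e_i^*` and put `c = g ∞`. The vertical geodesic from
`∞` to `c` runs inside `F`, crosses `e_i`, and then runs inside `g F` down to its cusp. So `e_i` is
the only translate `γ e_j` that it meets (`eq_or_eq_of_separated`). Counting the points of a divisor
that exceed `c` detects a crossing, so these functionals and their translates are, up to sign, dual
to the family.

Spanning: let `D` be the span of the translates. The cusps `g ∞` are dense, and each one in `(0, 1)`
lies below an arc. So the arcs form a chain without gaps, and all rational vertices of `F` agree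
modulo `D`. Replace each cusp `g ∞` by `g 0`; the ambiguity `T ^ n 0 - 0` lies in `D`. Every Farey
edge has a translate that meets `F`, whose ends are vertices or `∞`, so after replacement the two
ends agree modulo `D`. The Farey graph is connected, since `S` and `T` generate `SL₂(ℤ)`; thus all
cusps in `C` agree modulo `D` (`single_sub_single_mem`).

Finally, the translates of the `r_j e_i` under `Γ` are this same basis, so a partial symbol may take
arbitrary values at the `r_j e_i` and is determined by them (`exists_symb_equiv`). -/

/-! ### Linear fractional action in coordinates; sides and orientation of paths -/

theorem toPSL_surjective : Function.Surjective toPSL := QuotientGroup.mk'_surjective _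

theorem toPSL_smul_upperHalfPlane (A : SL(2, ℤ)) (z : ℍ) : toPSL A • z = A • z := rfl

theorem toPSL_smul_infty (A : SL(2, ℤ)) :
    toPSL A • (∞ : P1Q) = if (A 1 0 : ℚ) = 0 then ∞ else (((A 0 0 : ℚ) / A 1 0 : ℚ) : P1Q) := by
  change (Matrix.SpecialLinearGroup.mapGL ℚ A) • (∞ : P1Q) = _
  rw [OnePoint.smul_infty_eq_ite]
  simp

theorem toPSL_smul_coe (A : SL(2, ℤ)) (v : ℚ) :
    toPSL A • (v : P1Q) = if (A 1 0 : ℚ) * v + A 1 1 = 0 then ∞ else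
      ((((A 0 0 : ℚ) * v + A 0 1) / (A 1 0 * v + A 1 1) : ℚ) : P1Q) := by
  change (Matrix.SpecialLinearGroup.mapGL ℚ A) • (v : P1Q) = _
  rw [OnePoint.smul_some_eq_ite]
  simp

theorem det_eq_one (A : SL(2, ℤ)) : A 0 0 * A 1 1 - A 0 1 * A 1 0 = 1 := by
  rw [← Matrix.det_fin_two]; exact A.det_coe

theorem re_toPSL_smul (A : SL(2, ℤ)) (z : ℍ) :
    0 < (((A 1 0 : ℝ) * z.re + A 1 1) ^ 2 + (A 1 0 * z.im) ^ 2)⁻¹ ∧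
    (toPSL A • z).re = (((A 1 0 : ℝ) * z.re + A 1 1) ^ 2 + (A 1 0 * z.im) ^ 2)⁻¹ *
      (A 0 0 * A 1 0 * (z.re ^ 2 + z.im ^ 2) +
      (A 0 0 * A 1 1 + A 0 1 * A 1 0) * z.re + A 0 1 * A 1 1) := by
  rw [toPSL_smul_upperHalfPlane]
  have h := UpperHalfPlane.coe_specialLinearGroup_apply A z
  have hre : (A • z).re = ((A • z : ℍ) : ℂ).re := rfl
  have hne : ((A 1 0 : ℂ) * z + A 1 1) ≠ 0 := by
    intro h0
    have h1 := congrArg Complex.im h0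
    have h2 := congrArg Complex.re h0
    simp at h1 h2
    have := det_eq_one A
    rcases h1 with h1 | h1
    · simp [h1] at h2
      simp [h1, h2] at this
    · exact z.im_ne_zero h1
  have hk : ((A 1 0 : ℝ) * z.re + A 1 1) ^ 2 + (A 1 0 * z.im) ^ 2 =
      Complex.normSq ((A 1 0 : ℂ) * z + A 1 1) := by
    rw [Complex.normSq_apply]
    simp
    ring
  rw [hk]
  refine ⟨inv_pos.mpr (Complex.normSq_pos.mpr hne), ?_⟩
  rw [hre, h]
  simp only [algebraMap_int_eq, eq_intCast, Complex.ofReal_intCast]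
  rw [Complex.div_re]
  simp
  ring

theorem exists_re_toPSL_smul (A : SL(2, ℤ)) (z : ℍ) :
    ∃ k : ℝ, 0 < k ∧ (toPSL A • z).re = k * (A 0 0 * A 1 0 * (z.re ^ 2 + z.im ^ 2) +
      (A 0 0 * A 1 1 + A 0 1 * A 1 0) * z.re + A 0 1 * A 1 1) :=
  ⟨_, re_toPSL_smul A z⟩

theorem continuous_smul_upperHalfPlane (γ : PSL(2, ℤ)) : Continuous (fun z : ℍ => γ • z) := by
  obtain ⟨A, rfl⟩ := toPSL_surjective γ
  change Continuous (fun z : ℍ => Matrix.SpecialLinearGroup.mapGL ℝ A • z)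
  exact continuous_const_smul _

theorem mem_pathSet {γ : PSL(2, ℤ)} {z : ℍ} : z ∈ pathSet γ ↔ (γ⁻¹ • z).re = 0 := by
  constructor
  · rintro ⟨w, hw, rfl⟩
    simpa using hw
  · intro h
    exact ⟨γ⁻¹ • z, h, smul_inv_smul _ _⟩

theorem mem_rightSide {γ : PSL(2, ℤ)} {z : ℍ} : z ∈ rightSide γ ↔ 0 < (γ⁻¹ • z).re := by
  constructor
  · rintro ⟨w, hw, rfl⟩
    simpa using hw
  · intro h
    exact ⟨γ⁻¹ • z, h, smul_inv_smul _ _⟩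

theorem smul_mem_pathSet {g γ : PSL(2, ℤ)} {z : ℍ} : g • z ∈ pathSet (g * γ) ↔ z ∈ pathSet γ := by
  rw [mem_pathSet, mem_pathSet, mul_inv_rev, mul_smul, inv_smul_smul]

theorem smul_mem_rightSide {g γ : PSL(2, ℤ)} {z : ℍ} :
    g • z ∈ rightSide (g * γ) ↔ z ∈ rightSide γ := by
  rw [mem_rightSide, mem_rightSide, mul_inv_rev, mul_smul, inv_smul_smul]

theorem toPSL_neg (A : SL(2, ℤ)) : toPSL (-A) = toPSL A := by
  have h : (-1 : SL(2, ℤ)) ∈ Subgroup.center SL(2, ℤ) :=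
    Subgroup.mem_center_iff.mpr fun g => by simp
  have h1 : toPSL (-1) = 1 := (QuotientGroup.eq_one_iff _).mpr h
  rw [← neg_one_mul, map_mul, h1, one_mul]

theorem S_entries : ModularGroup.S 0 0 = 0 ∧ ModularGroup.S 0 1 = -1 ∧ ModularGroup.S 1 0 = 1 ∧
    ModularGroup.S 1 1 = 0 := ⟨rfl, rfl, rfl, rfl⟩

theorem toPSL_S_mul_self : toPSL ModularGroup.S * toPSL ModularGroup.S = 1 := by
  rw [← map_mul, ← map_one toPSL, ← toPSL_neg 1]
  congr 1
  ext i j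
  fin_cases i <;> fin_cases j <;> simp [Matrix.mul_apply]

theorem toPSL_S_inv : (toPSL ModularGroup.S)⁻¹ = toPSL ModularGroup.S :=
  inv_eq_of_mul_eq_one_right toPSL_S_mul_self

theorem pathReverse_pathReverse (γ : PSL(2, ℤ)) : pathReverse (pathReverse γ) = γ := by
  rw [pathReverse, pathReverse, mul_assoc, toPSL_S_mul_self, mul_one]

theorem mul_pathReverse (g γ : PSL(2, ℤ)) : pathReverse (g * γ) = g * pathReverse γ := by
  rw [pathReverse, pathReverse, mul_assoc]

theorem re_S_smul (z : ℍ) : ∃ k : ℝ, 0 < k ∧ (toPSL ModularGroup.S • z).re = -(k * z.re) := by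
  obtain ⟨k, hk, h⟩ := exists_re_toPSL_smul ModularGroup.S z
  exact ⟨k, hk, by rw [h]; simp [ModularGroup.S]⟩

theorem mem_pathSet_pathReverse {γ : PSL(2, ℤ)} {z : ℍ} :
    z ∈ pathSet (pathReverse γ) ↔ z ∈ pathSet γ := by
  rw [mem_pathSet, mem_pathSet, pathReverse, mul_inv_rev, mul_smul, toPSL_S_inv]
  obtain ⟨k, hk, h⟩ := re_S_smul (γ⁻¹ • z)
  rw [h]
  simp [hk.ne']

theorem mem_rightSide_pathReverse {γ : PSL(2, ℤ)} {z : ℍ} :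
    z ∈ rightSide (pathReverse γ) ↔ (γ⁻¹ • z).re < 0 := by
  rw [mem_rightSide, pathReverse, mul_inv_rev, mul_smul, toPSL_S_inv]
  obtain ⟨k, hk, h⟩ := re_S_smul (γ⁻¹ • z)
  rw [h, neg_pos]
  exact ⟨fun h => by nlinarith, fun h => by nlinarith⟩

theorem S_smul_infty : toPSL ModularGroup.S • (∞ : P1Q) = ((0 : ℚ) : P1Q) := by
  rw [toPSL_smul_infty]; simp [ModularGroup.S]

theorem S_smul_zero : toPSL ModularGroup.S • ((0 : ℚ) : P1Q) = ∞ := by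
  rw [toPSL_smul_coe]; simp [ModularGroup.S]

theorem S_smul_coe {w : ℚ} (hw : w ≠ 0) :
    toPSL ModularGroup.S • (w : P1Q) = ((-w⁻¹ : ℚ) : P1Q) := by
  rw [toPSL_smul_coe]; simp [ModularGroup.S, hw, neg_div]

theorem T_smul_infty : toPSL ModularGroup.T • (∞ : P1Q) = ∞ := by
  rw [toPSL_smul_infty]; simp [ModularGroup.T]

/-! ### Unimodular paths do not cross -/

/-- The cusp `v` is not a negative rational number. -/
def CuspNonneg (v : P1Q) : Prop := ∀ w : ℚ, v = w → 0 ≤ w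

/-- With `n = A 0 1 * A 1 0` the determinant gives `A 0 0 * A 1 1 = n + 1`, so the product is `n (n
+ 1)`. -/
theorem mul_nonneg_of_det (A : SL(2, ℤ)) :
    0 ≤ (A 0 0 * A 1 0) * (A 0 1 * A 1 1) := by
  have h := det_eq_one A
  have : (A 0 0 * A 1 0) * (A 0 1 * A 1 1) = (A 0 1 * A 1 0) * (A 0 1 * A 1 0 + 1) := by
    have : A 0 0 * A 1 1 = A 0 1 * A 1 0 + 1 := by linarith
    rw [← this]; ring
  rw [this]
  rcases le_or_gt 0 (A 0 1 * A 1 0) with h | h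
  · positivity
  · exact mul_nonneg_of_nonpos_of_nonpos h.le (by omega)

/-- For `z = iy` the real part is a positive multiple of `m y² + n`, with `m`, `n` the two products
of the conclusion. These do not have opposite signs, so a nonnegative value forces both to be
nonnegative. They carry the signs of the end points of the path. -/
theorem entries_nonneg (A : SL(2, ℤ)) {z : ℍ} (hz : z.re = 0)
    (h : 0 ≤ (toPSL A • z).re) : 0 ≤ A 0 0 * A 1 0 ∧ 0 ≤ A 0 1 * A 1 1 := by
  obtain ⟨k, hk, e⟩ := exists_re_toPSL_smul A z
  rw [e, hz] at h
  have h2 := nonneg_of_mul_nonneg_right h hk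
  have hn := mul_nonneg_of_det A
  have hy : 0 < z.im ^ 2 := pow_pos z.im_pos 2
  have h3 : 0 ≤ ((A 0 0 * A 1 0 : ℤ) : ℝ) * z.im ^ 2 + ((A 0 1 * A 1 1 : ℤ) : ℝ) := by
    push_cast; linarith
  generalize A 0 0 * A 1 0 = m at *
  generalize A 0 1 * A 1 1 = n at *
  rcases lt_or_ge m 0 with hm | hm
  · have hn' : n ≤ 0 := by nlinarith
    exfalso
    have : (m : ℝ) < 0 := by exact_mod_cast hm
    have : (n : ℝ) ≤ 0 := by exact_mod_cast hn'
    nlinarith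
  · refine ⟨hm, ?_⟩
    by_contra! hlt
    have hm0 : m = 0 := by nlinarith
    rw [hm0] at h3
    simp at h3
    omega

/-- Unimodular paths do not cross: a path through a point to the right of `e_γ` ends to the right
of `e_γ`. -/
theorem cuspNonneg_of_re_nonneg {γ δ : PSL(2, ℤ)} {z : ℍ} (hz : z ∈ pathSet δ)
    (h : 0 ≤ (γ⁻¹ • z).re) :
    CuspNonneg (γ⁻¹ • δ • (∞ : P1Q)) ∧ CuspNonneg (γ⁻¹ • δ • ((0 : ℚ) : P1Q)) := by
  obtain ⟨A, hA⟩ := toPSL_surjective (γ⁻¹ * δ)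
  obtain ⟨w, hw, rfl⟩ := hz
  dsimp only at h
  rw [← mul_smul, ← hA] at h
  obtain ⟨h1, h2⟩ := entries_nonneg A hw h
  rw [← mul_smul, ← mul_smul, ← hA, toPSL_smul_infty, toPSL_smul_coe]
  -- `a / b = (a b) b⁻²`, also for `b = 0`, where both sides are zero.
  have key : ∀ a b : ℤ, 0 ≤ a * b → (0 : ℚ) ≤ a / b := by
    intro a b hab
    rw [div_eq_mul_inv, ← mul_self_mul_inv (b : ℚ)⁻¹, inv_inv]
    have : (0 : ℚ) ≤ a * b := by exact_mod_cast hab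
    have h2 : (a : ℚ) * ((b : ℚ)⁻¹ * (b : ℚ)⁻¹ * b) = (a * b) * ((b : ℚ)⁻¹ * (b : ℚ)⁻¹) := by ring
    rw [h2]
    exact mul_nonneg this (mul_self_nonneg _)
  constructor
  · intro w hw
    split_ifs at hw
    · exact absurd hw (OnePoint.infty_ne_coe w)
    · rw [OnePoint.coe_eq_coe] at hw
      rw [← hw]; exact key _ _ h1
  · intro w hw
    split_ifs at hw
    · exact absurd hw (OnePoint.infty_ne_coe w)
    · rw [OnePoint.coe_eq_coe] at hw
      rw [← hw]; simpa using key _ _ h2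

/-- Both products of entries vanish, so the matrix is diagonal or antidiagonal; up to sign it is the
identity or `S`. -/
theorem eq_one_or_S_of_re_eq_zero {M : PSL(2, ℤ)} {z : ℍ} (hz : z.re = 0)
    (h : (M • z).re = 0) : M = 1 ∨ M = toPSL ModularGroup.S := by
  obtain ⟨A, rfl⟩ := toPSL_surjective M
  obtain ⟨h1, h2⟩ := entries_nonneg A hz h.ge
  obtain ⟨k, hk, e⟩ := exists_re_toPSL_smul A z
  rw [e, hz] at h
  have hy : 0 < z.im ^ 2 := pow_pos z.im_pos 2
  have h3 : ((A 0 0 * A 1 0 : ℤ) : ℝ) * z.im ^ 2 + ((A 0 1 * A 1 1 : ℤ) : ℝ) = 0 := by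
    have := (mul_eq_zero.mp h).resolve_left hk.ne'
    push_cast; linarith
  have h1' : (0 : ℝ) ≤ ((A 0 0 * A 1 0 : ℤ) : ℝ) := by exact_mod_cast h1
  have h2' : (0 : ℝ) ≤ ((A 0 1 * A 1 1 : ℤ) : ℝ) := by exact_mod_cast h2
  have h4 : ((A 0 0 * A 1 0 : ℤ) : ℝ) = 0 := by nlinarith
  have h5 : ((A 0 1 * A 1 1 : ℤ) : ℝ) = 0 := by nlinarith
  rw [Int.cast_eq_zero] at h4 h5
  have hd := det_eq_one A
  have ext_entries : ∀ B : SL(2, ℤ), A 0 0 = B 0 0 → A 0 1 = B 0 1 → A 1 0 = B 1 0 → A 1 1 = B 1 1 →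
      A = B := by
    intro B a b c d
    ext i j
    fin_cases i <;> fin_cases j <;> assumption
  rcases mul_eq_zero.mp h4 with ha | hc
  · right
    rw [ha] at hd
    have hb : A 0 1 ≠ 0 := by rintro hb; simp [hb] at hd
    have hd0 := (mul_eq_zero.mp h5).resolve_left hb
    have hbc : A 0 1 * A 1 0 = -1 := by linarith
    rcases Int.isUnit_iff.mp (IsUnit.of_mul_eq_one (-A 1 0) (by linarith : A 0 1 * (-A 1 0) = 1))
      with hb1 | hb1
    · rw [ext_entries (-ModularGroup.S) (by simp [ha]) (by simp [hb1])
        (by rw [hb1] at hbc; simp; linarith) (by simp [hd0]),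
        toPSL_neg]
    · rw [ext_entries (ModularGroup.S) (by simp [ha, S_entries]) (by simp [hb1, S_entries])
        (by rw [hb1] at hbc; simp [S_entries]; linarith) (by simp [hd0, S_entries])]
  · left
    rw [hc] at hd
    have hd0 : A 1 1 ≠ 0 := by rintro hb; simp [hb] at hd
    have hb0 := (mul_eq_zero.mp h5).resolve_right hd0
    have hbc : A 0 0 * A 1 1 = 1 := by linarith
    rcases Int.isUnit_iff.mp (IsUnit.of_mul_eq_one _ hbc) with hb1 | hb1
    · rw [ext_entries 1 (by simp [hb1]) (by simp [hb0]) (by simp [hc]) (by rw [hb1] at hbc; simpa using hbc),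
        map_one]
    · rw [ext_entries (-1) (by simp [hb1]) (by simp [hb0]) (by simp [hc])
        (by rw [hb1] at hbc; simp; linarith), toPSL_neg, map_one]

/-- A unimodular path through a point of `e_γ` is `e_γ` up to orientation. -/
theorem eq_or_eq_pathReverse {γ δ : PSL(2, ℤ)} {z : ℍ} (hγ : z ∈ pathSet γ) (hδ : z ∈ pathSet δ) :
    δ = γ ∨ δ = pathReverse γ := by
  rw [mem_pathSet] at hγ
  obtain ⟨w, hw, rfl⟩ := hδ
  dsimp only at hγ
  rw [← mul_smul] at hγ
  rcases eq_one_or_S_of_re_eq_zero hw hγ with h | h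
  · left; rw [inv_mul_eq_one] at h; exact h.symm
  · right; rw [inv_mul_eq_iff_eq_mul] at h; exact h

/-- A unimodular path between rational numbers is a half circle. -/
theorem exists_endpoints (γ : PSL(2, ℤ)) (h : γ • (∞ : P1Q) ≠ ∞)
    (h0 : γ • ((0 : ℚ) : P1Q) ≠ ∞) : ∃ p q : ℚ, γ • ((0 : ℚ) : P1Q) = p ∧ γ • (∞ : P1Q) = q ∧
      p ≠ q ∧
      (∀ z : ℍ, ∃ k : ℝ, 0 < k ∧ (γ⁻¹ • z).re * (p - q) =
        k * (z.im ^ 2 + (z.re - p) * (z.re - q))) ∧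
      (∃ w : ℚ, γ⁻¹ • (∞ : P1Q) = w ∧ 0 < w * (p - q)) ∧
      (∀ v : ℚ, v ≠ q → ∃ (w k : ℚ), γ⁻¹ • (v : P1Q) = w ∧ 0 < k ∧
        w * (p - q) = k * ((v - p) * (v - q))) := by
  obtain ⟨A, rfl⟩ := toPSL_surjective γ
  rw [toPSL_smul_infty] at h ⊢
  rw [toPSL_smul_coe, mul_zero, mul_zero, zero_add, zero_add] at h0 ⊢
  have hc : (A 1 0 : ℚ) ≠ 0 := by rintro hc; simp [hc] at h
  have hd : (A 1 1 : ℚ) ≠ 0 := by rintro hc; simp [hc] at h0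
  rw [if_neg hc, if_neg hd]
  have hdet : (A 0 0 : ℚ) * A 1 1 - A 0 1 * A 1 0 = 1 := by exact_mod_cast det_eq_one A
  have hpq : (A 0 1 : ℚ) / A 1 1 - A 0 0 / A 1 0 =
      - (1 / (A 1 0 * A 1 1)) := by
    field_simp
    linear_combination -hdet
  have i00 : A⁻¹ 0 0 = A 1 1 := by simp [Matrix.SpecialLinearGroup.SL2_inv_expl]
  have i01 : A⁻¹ 0 1 = -A 0 1 := by simp [Matrix.SpecialLinearGroup.SL2_inv_expl]
  have i10 : A⁻¹ 1 0 = -A 1 0 := by simp [Matrix.SpecialLinearGroup.SL2_inv_expl]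
  have i11 : A⁻¹ 1 1 = A 0 0 := by simp [Matrix.SpecialLinearGroup.SL2_inv_expl]
  refine ⟨_, _, rfl, rfl, ?_, ?_, ?_, ?_⟩
  · rw [← sub_ne_zero, hpq]
    simp [hc, hd]
  · intro z
    obtain ⟨k, hk, e⟩ := exists_re_toPSL_smul A⁻¹ z
    refine ⟨k, hk, ?_⟩
    rw [← map_inv, e, i00, i01, i10, i11, ← Rat.cast_sub, hpq]
    have hc' : (A 1 0 : ℝ) ≠ 0 := by exact_mod_cast hc
    have hd' : (A 1 1 : ℝ) ≠ 0 := by exact_mod_cast hd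
    push_cast
    field_simp
    ring
  · rw [← map_inv, toPSL_smul_infty, i00, i10, hpq, if_neg (by simpa using hc)]
    refine ⟨_, rfl, ?_⟩
    have : ((A 1 1 : ℚ) / (-A 1 0 : ℤ)) * -(1 / (A 1 0 * A 1 1)) = (1 / A 1 0) ^ 2 := by
      push_cast
      field_simp
    rw [this]
    positivity
  · intro v hv
    rw [← map_inv, toPSL_smul_coe, i00, i01, i10, i11, hpq]
    push_cast
    have hne : -(A 1 0 : ℚ) * v + A 0 0 ≠ 0 := by
      intro h0
      apply hv
      field_simp
      linarith
    rw [if_neg hne]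
    refine ⟨_, (1 / (-(A 1 0 : ℚ) * v + A 0 0)) ^ 2, rfl, by positivity, ?_⟩
    obtain ⟨n, hn⟩ : ∃ n, n = -(A 1 0 : ℚ) * v + A 0 0 := ⟨_, rfl⟩
    rw [← hn] at hne ⊢
    rw [show (A 0 0 : ℚ) = n + A 1 0 * v by rw [hn]; ring]
    field_simp
    ring

/-! ### Triangles of the Farey tessellation -/

/-- The open ideal triangle with vertices `0`, `1`, `∞`. -/
def triangle : Set ℍ := {z | 0 < z.re ∧ z.re < 1 ∧ z.re < z.re ^ 2 + z.im ^ 2}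

/-- The translate by `γ` of the ideal triangle with vertices `0`, `1`, `∞`: the triangle of the
Farey tessellation that lies to the right of `e_γ`. -/
def triangleRight (γ : PSL(2, ℤ)) : Set ℍ := {z | γ⁻¹ • z ∈ triangle}

/-- The coordinates `x = re z` and `s = |z|² - re z` identify the triangle with a product of two
intervals. -/
theorem isPreconnected_triangle : IsPreconnected triangle := by
  rw [← UpperHalfPlane.isOpenEmbedding_coe.isInducing.isPreconnected_image]
  have : ((↑) : ℍ → ℂ) '' triangle = (fun p : ℝ × ℝ => (⟨p.1, √(p.1 - p.1 ^ 2 + p.2)⟩ : ℂ)) ''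
      (Set.Ioo (0 : ℝ) 1 ×ˢ Set.Ioi (0 : ℝ)) := by
    ext w
    constructor
    · rintro ⟨z, ⟨h0, h1, h2⟩, rfl⟩
      refine ⟨(z.re, z.re ^ 2 + z.im ^ 2 - z.re), ⟨⟨h0, h1⟩, by simpa using h2⟩, ?_⟩
      apply Complex.ext
      · rfl
      · simp only [UpperHalfPlane.coe_im]
        rw [show z.re - z.re ^ 2 + (z.re ^ 2 + z.im ^ 2 - z.re) = z.im ^ 2 by ring,
          Real.sqrt_sq z.im_pos.le]
    · rintro ⟨⟨x, s⟩, ⟨⟨h0, h1⟩, h2⟩, rfl⟩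
      simp only [Set.mem_Ioi] at h0 h1 h2 ⊢
      have hpos : 0 < x - x ^ 2 + s := by nlinarith
      refine ⟨⟨⟨x, √(x - x ^ 2 + s)⟩, Real.sqrt_pos.mpr hpos⟩, ⟨h0, h1, ?_⟩, rfl⟩
      change x < x ^ 2 + √(x - x ^ 2 + s) ^ 2
      rw [Real.sq_sqrt hpos.le]
      linarith
  rw [this]
  refine (isPreconnected_Ioo.prod isPreconnected_Ioi).image _ (Continuous.continuousOn ?_)
  have : (fun p : ℝ × ℝ => (⟨p.1, √(p.1 - p.1 ^ 2 + p.2)⟩ : ℂ)) =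
      fun p : ℝ × ℝ => (p.1 : ℂ) + (√(p.1 - p.1 ^ 2 + p.2) : ℝ) * Complex.I := by
    ext p
    apply Complex.ext <;> simp
  rw [this]
  fun_prop

theorem triangleRight_eq_image (γ : PSL(2, ℤ)) : triangleRight γ = (γ • ·) '' triangle := by
  ext z
  exact ⟨fun h => ⟨_, h, smul_inv_smul _ _⟩, by rintro ⟨w, hw, rfl⟩; simpa [triangleRight] using hw⟩

theorem isPreconnected_triangleRight (γ : PSL(2, ℤ)) : IsPreconnected (triangleRight γ) := by
  rw [triangleRight_eq_image]
  exact isPreconnected_triangle.image _ (continuous_smul_upperHalfPlane γ).continuousOn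

theorem smul_mem_triangleRight {g γ : PSL(2, ℤ)} {z : ℍ} :
    g • z ∈ triangleRight (g * γ) ↔ z ∈ triangleRight γ := by
  simp only [triangleRight, Set.mem_ofPred_eq]
  rw [mul_inv_rev, mul_smul, inv_smul_smul]

theorem mul_entry (A B : SL(2, ℤ)) (i j : Fin 2) :
    (A * B) i j = A i 0 * B 0 j + A i 1 * B 1 j := by
  rw [Matrix.SpecialLinearGroup.coe_mul, Matrix.mul_apply, Fin.sum_univ_two]

theorem TS_inv_entries : (ModularGroup.T * ModularGroup.S)⁻¹ 0 0 = 0 ∧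
    (ModularGroup.T * ModularGroup.S)⁻¹ 0 1 = 1 ∧ (ModularGroup.T * ModularGroup.S)⁻¹ 1 0 = -1 ∧
    (ModularGroup.T * ModularGroup.S)⁻¹ 1 1 = 1 := by
  refine ⟨?_, ?_, ?_, ?_⟩ <;> decide

/-- `pathInfty` has order three and rotates the triangle. The three inequalities defining `triangle`
thus say that `z`, `pathInfty⁻¹ • z` and `pathInfty⁻² • z` have positive real part. -/
theorem pathInfty_inv_mul (A : SL(2, ℤ)) : ∃ B : SL(2, ℤ), pathInfty⁻¹ * toPSL A = toPSL B ∧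
    B 0 0 = A 1 0 ∧ B 0 1 = A 1 1 ∧ B 1 0 = A 1 0 - A 0 0 ∧ B 1 1 = A 1 1 - A 0 1 := by
  obtain ⟨h1, h2, h3, h4⟩ := TS_inv_entries
  refine ⟨(ModularGroup.T * ModularGroup.S)⁻¹ * A, by rw [map_mul, map_inv, pathInfty], ?_⟩
  simp only [mul_entry (ModularGroup.T * ModularGroup.S)⁻¹ A, h1, h2, h3, h4]
  refine ⟨?_, ?_, ?_, ?_⟩ <;> ring

theorem pathInfty_inv_smul_re (z : ℍ) :
    ∃ k : ℝ, 0 < k ∧ (pathInfty⁻¹ • z).re = k * (1 - z.re) := by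
  obtain ⟨B, hB, b1, b2, b3, b4⟩ := pathInfty_inv_mul 1
  obtain ⟨k, hk, h⟩ := exists_re_toPSL_smul B z
  refine ⟨k, hk, ?_⟩
  rw [map_one, mul_one] at hB
  rw [hB, h, b1, b2, b3, b4]
  simp
  ring_nf
  simp

theorem pathInfty_inv_sq_smul_re (z : ℍ) : ∃ k : ℝ, 0 < k ∧
    (pathInfty⁻¹ • pathInfty⁻¹ • z).re = k * (z.re ^ 2 + z.im ^ 2 - z.re) := by
  obtain ⟨B, hB, b1, b2, b3, b4⟩ := pathInfty_inv_mul 1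
  obtain ⟨C, hC, c1, c2, c3, c4⟩ := pathInfty_inv_mul B
  obtain ⟨k, hk, h⟩ := exists_re_toPSL_smul C z
  refine ⟨k, hk, ?_⟩
  rw [map_one, mul_one] at hB
  rw [← mul_smul, ← hB] at *
  rw [hC, h, c1, c2, c3, c4, b1, b2, b3, b4]
  simp
  ring_nf
  simp

theorem mul_entries_pos {A : SL(2, ℤ)} {w : ℍ} (hw : w.re = 0) (h : 0 < (toPSL A • w).re) :
    A 0 0 * A 1 0 ≠ 0 ∨ A 0 1 * A 1 1 ≠ 0 := by
  by_contra! hc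
  obtain ⟨k, hk, e⟩ := exists_re_toPSL_smul A w
  have h1 : (A 0 0 : ℝ) * A 1 0 = 0 := by exact_mod_cast hc.1
  have h2 : (A 0 1 : ℝ) * A 1 1 = 0 := by exact_mod_cast hc.2
  rw [e, hw, h1, h2] at h
  simp at h

/-- The end point `a / c` is on the inner side, in the weak sense, of all three sides of the
triangle: it is at least 0, at most 1, and not inside `(0, 1)`. Only the vertices remain. -/
theorem eq_of_mul_nonneg {a c : ℤ} (h1 : 0 ≤ a * c) (h2 : 0 ≤ c * (c - a))
    (h3 : 0 ≤ (c - a) * (-a)) : a = 0 ∨ c = 0 ∨ a = c := by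
  by_cases ha : a = 0
  · exact Or.inl ha
  by_cases hc : c = 0
  · exact Or.inr (Or.inl hc)
  right; right
  rcases lt_or_gt_of_ne ha with ha | ha <;> rcases lt_or_gt_of_ne hc with hc | hc <;> nlinarith

/-- Since paths do not cross, both ends of a path through the triangle are weakly inside each of its
sides, hence are vertices. The path would then be a side, but the point is strictly inside all
three. -/
theorem notMem_pathSet_of_mem_triangle {z : ℍ} (hz : z ∈ triangle) (δ : PSL(2, ℤ)) :
    z ∉ pathSet δ := by
  rintro ⟨w, hw, rfl⟩
  obtain ⟨A, rfl⟩ := toPSL_surjective δ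
  obtain ⟨B, hB, b1, b2, b3, b4⟩ := pathInfty_inv_mul A
  obtain ⟨C, hC, c1, c2, c3, c4⟩ := pathInfty_inv_mul B
  obtain ⟨h1, h2, h3⟩ := hz
  dsimp only at h1 h2 h3
  obtain ⟨k, hk, e⟩ := pathInfty_inv_smul_re (toPSL A • w)
  obtain ⟨k', hk', e'⟩ := pathInfty_inv_sq_smul_re (toPSL A • w)
  have pB : 0 < (toPSL B • w).re := by
    rw [← hB, mul_smul, e]; exact mul_pos hk (by linarith)
  have pC : 0 < (toPSL C • w).re := by
    rw [← hC, ← hB, mul_smul, mul_smul, e']; exact mul_pos hk' (by linarith)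
  obtain ⟨nA, nA'⟩ := entries_nonneg A hw h1.le
  obtain ⟨nB, nB'⟩ := entries_nonneg B hw pB.le
  obtain ⟨nC, nC'⟩ := entries_nonneg C hw pC.le
  have zA := mul_entries_pos hw h1
  have zB := mul_entries_pos hw pB
  have zC := mul_entries_pos hw pC
  have hd := det_eq_one A
  rw [c1, c3, b1, b3] at nC zC
  rw [c2, c4, b2, b4] at nC' zC
  rw [b1, b3] at nB zB
  rw [b2, b4] at nB' zB
  rw [show A 1 0 - A 0 0 - A 1 0 = -A 0 0 by ring] at nC zC
  rw [show A 1 1 - A 0 1 - A 1 1 = -A 0 1 by ring] at nC' zC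
  generalize A 0 0 = a at *
  generalize A 0 1 = b at *
  generalize A 1 0 = c at *
  generalize A 1 1 = d at *
  rcases eq_of_mul_nonneg nA nB nC with rfl | rfl | rfl <;>
  rcases eq_of_mul_nonneg nA' nB' nC' with rfl | rfl | rfl <;> simp at zA zB zC hd

theorem disjoint_triangleRight_pathSet (γ δ : PSL(2, ℤ)) :
    Disjoint (triangleRight γ) (pathSet δ) := by
  rw [Set.disjoint_left]
  intro z hz hδ
  refine notMem_pathSet_of_mem_triangle hz (γ⁻¹ * δ) (smul_mem_pathSet.mpr hδ)

theorem triangleRight_subset_rightSide (γ : PSL(2, ℤ)) : triangleRight γ ⊆ rightSide γ :=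
  fun _ hz => mem_rightSide.mpr hz.1

theorem continuous_re_smul (γ : PSL(2, ℤ)) : Continuous fun z : ℍ => (γ • z).re :=
  UpperHalfPlane.continuous_re.comp (continuous_smul_upperHalfPlane γ)

theorem isOpen_rightSide (γ : PSL(2, ℤ)) : IsOpen (rightSide γ) := by
  have : rightSide γ = {z | 0 < (γ⁻¹ • z).re} := by ext; exact mem_rightSide
  rw [this]
  exact isOpen_lt continuous_const (continuous_re_smul _)

/-- The conditions for the other two sides are open and hold on the edge. -/
theorem triangleRight_mem_nhdsWithin {γ : PSL(2, ℤ)} {z : ℍ} (hz : z ∈ pathSet γ) :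
    triangleRight γ ∈ 𝓝[rightSide γ] z := by
  have hc := continuous_smul_upperHalfPlane γ⁻¹
  have h1 : IsOpen {w : ℍ | (γ⁻¹ • w).re < 1 ∧
      (γ⁻¹ • w).re < (γ⁻¹ • w).re ^ 2 + (γ⁻¹ • w).im ^ 2} := by
    have hre := UpperHalfPlane.continuous_re.comp hc
    have him := UpperHalfPlane.continuous_im.comp hc
    apply IsOpen.inter
    · exact isOpen_lt hre continuous_const
    · exact isOpen_lt hre ((hre.pow 2).add (him.pow 2))
  rw [mem_nhdsWithin]
  refine ⟨_, h1, ?_, ?_⟩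
  · rw [mem_pathSet] at hz
    simp only [Set.mem_ofPred_eq, hz]
    have := (γ⁻¹ • z).im_pos
    constructor
    · norm_num
    · positivity
  · rintro w ⟨⟨h1, h2⟩, h3⟩
    exact ⟨mem_rightSide.mp h3, h1, h2⟩

theorem mem_closure_rightSide {γ : PSL(2, ℤ)} {z : ℍ} (hz : z ∈ pathSet γ) :
    z ∈ closure (rightSide γ) := by
  rw [mem_pathSet] at hz
  let f : ℝ → ℍ := fun t => γ • (t +ᵥ (γ⁻¹ • z))
  have hf : Continuous f := (continuous_smul_upperHalfPlane γ).comp (by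
    rw [UpperHalfPlane.isOpenEmbedding_coe.isInducing.continuous_iff]
    change Continuous fun t : ℝ => (t : ℂ) + ((γ⁻¹ • z : ℍ) : ℂ)
    fun_prop)
  have h0 : f 0 = z := by simp [f]
  rw [← h0]
  refine map_mem_closure hf (s := Set.Ioi 0) ?_ ?_
  · rw [closure_Ioi]; simp
  · intro t ht
    rw [mem_rightSide]
    simpa [f, hz] using ht

theorem IsPreconnected.subset_interior_of_disjoint_frontier {X : Type*} [TopologicalSpace X]
    {s t : Set X} (ht : IsPreconnected t) (h : (t ∩ s).Nonempty) (hd : Disjoint t (frontier s)) :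
    t ⊆ interior s := by
  refine ht.subset_left_of_subset_union isOpen_interior isClosed_closure.isOpen_compl
    (Set.disjoint_compl_right_iff_subset.mpr (interior_subset.trans subset_closure)) ?_ ?_
  · intro x hx
    by_contra hc
    simp only [Set.mem_union, Set.mem_compl_iff, not_or, not_not] at hc
    exact Set.disjoint_left.mp hd hx ⟨hc.2, hc.1⟩
  · obtain ⟨x, hx, hs⟩ := h
    refine ⟨x, hx, ?_⟩
    by_contra hc
    exact Set.disjoint_left.mp hd hx ⟨subset_closure hs, hc⟩

theorem mem_rightSide_or_mem_pathSet_or (γ : PSL(2, ℤ)) (z : ℍ) :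
    z ∈ rightSide γ ∨ z ∈ pathSet γ ∨ z ∈ rightSide (pathReverse γ) := by
  rw [mem_rightSide, mem_pathSet, mem_rightSide_pathReverse]
  rcases lt_trichotomy (γ⁻¹ • z).re 0 with h | h | h <;> tauto

theorem isPreconnected_vertical (x s : ℝ) (hs : 0 ≤ s) :
    IsPreconnected {z : ℍ | z.re = x ∧ s < z.im} := by
  rw [← UpperHalfPlane.isOpenEmbedding_coe.isInducing.isPreconnected_image]
  have : ((↑) : ℍ → ℂ) '' {z : ℍ | z.re = x ∧ s < z.im} =
      (fun y : ℝ => (x : ℂ) + y * Complex.I) '' Set.Ioi s := by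
    ext w
    constructor
    · rintro ⟨z, ⟨h1, h2⟩, rfl⟩
      refine ⟨z.im, h2, ?_⟩
      apply Complex.ext <;> simp [h1]
    · rintro ⟨y, hy, rfl⟩
      have hy' : s < y := hy
      refine ⟨⟨(x : ℂ) + y * Complex.I, by simp; linarith⟩, ⟨?_, ?_⟩, rfl⟩
      · change ((x : ℂ) + y * Complex.I).re = x
        simp
      · change s < ((x : ℂ) + y * Complex.I).im
        simpa using hy
  rw [this]
  exact isPreconnected_Ioi.image _ (Continuous.continuousOn (by fun_prop))

/-! ### Farey triangles and the sides of the domain -/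

namespace IsUnimodularDomain

variable {Γ : Subgroup PSL(2, ℤ)} {F : Set ℍ}

theorem isClosed (hF : IsUnimodularDomain Γ F) : IsClosed F := by
  rw [← hF.closure_interior]; exact isClosed_closure

theorem frontier_subset (hF : IsUnimodularDomain Γ F) : frontier F ⊆ F :=
  hF.isClosed.frontier_subset

/-- As `F` is the closure of its interior, an open set meeting `F` meets the interior; so an overlap
with the whole of a translate already contradicts disjointness of interiors. -/
theorem eq_one_of_mem (hF : IsUnimodularDomain Γ F) {g : PSL(2, ℤ)} (hg : g ∈ Γ) {z : ℍ}
    (hz : z ∈ interior F) (hz' : g⁻¹ • z ∈ F) : g = 1 := by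
  by_contra hne
  have hO : IsOpen {w : ℍ | g • w ∈ interior F} :=
    isOpen_interior.preimage (continuous_smul_upperHalfPlane g)
  rw [← hF.closure_interior, mem_closure_iff] at hz'
  obtain ⟨w, hw, hw'⟩ := hz' _ hO (by simpa using hz)
  exact Set.disjoint_left.mp (hF.disjoint_interior g hg hne) ⟨w, hw', rfl⟩ hw

theorem triangleRight_subset_or_disjoint (hF : IsUnimodularDomain Γ F) (γ : PSL(2, ℤ)) :
    triangleRight γ ⊆ interior F ∨ Disjoint (triangleRight γ) F := by
  by_cases h : (triangleRight γ ∩ F).Nonempty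
  · left
    refine IsPreconnected.subset_interior_of_disjoint_frontier (isPreconnected_triangleRight γ) h ?_
    obtain ⟨S, hS⟩ := hF.frontier_eq
    rw [hS]
    simp only [Set.disjoint_iUnion_right]
    exact fun i _ => disjoint_triangleRight_pathSet γ i
  · right
    rwa [Set.disjoint_iff_inter_eq_empty, ← Set.not_nonempty_iff_eq_empty]

theorem triangleRight_subset (hF : IsUnimodularDomain Γ F) {γ : PSL(2, ℤ)}
    (hγ : γ ∈ orientedBoundary F) : triangleRight γ ⊆ interior F := by
  refine (hF.triangleRight_subset_or_disjoint γ).resolve_right fun hd => ?_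
  have hz : γ • UpperHalfPlane.I ∈ pathSet γ := ⟨_, UpperHalfPlane.I_re, rfl⟩
  have : (𝓝[rightSide γ] (γ • UpperHalfPlane.I)).NeBot :=
    mem_closure_iff_nhdsWithin_neBot.mp (mem_closure_rightSide hz)
  obtain ⟨w, hw⟩ := Filter.nonempty_of_mem (Filter.inter_mem (triangleRight_mem_nhdsWithin hz)
    (hγ.2 _ hz))
  exact Set.disjoint_left.mp hd hw.1 hw.2

theorem mem_orientedBoundary_of_triangleRight {γ : PSL(2, ℤ)}
    (hγ : pathSet γ ⊆ frontier F) (h : triangleRight γ ⊆ interior F) : γ ∈ orientedBoundary F :=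
  ⟨hγ, fun _ hz => Filter.mem_of_superset (triangleRight_mem_nhdsWithin hz)
    (h.trans interior_subset)⟩

/-- If both triangles adjacent to the edge missed `F`, then near a point of the edge nothing would
belong to the interior, against `closure (interior F) = F`. -/
theorem mem_orientedBoundary_or (hF : IsUnimodularDomain Γ F) {γ : PSL(2, ℤ)}
    (hγ : pathSet γ ⊆ frontier F) :
    γ ∈ orientedBoundary F ∨ pathReverse γ ∈ orientedBoundary F := by
  have hγ' : pathSet (pathReverse γ) ⊆ frontier F :=
    fun z hz => hγ (mem_pathSet_pathReverse.mp hz)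
  rcases hF.triangleRight_subset_or_disjoint γ with h | h
  · exact Or.inl (mem_orientedBoundary_of_triangleRight hγ h)
  rcases hF.triangleRight_subset_or_disjoint (pathReverse γ) with h' | h'
  · exact Or.inr (mem_orientedBoundary_of_triangleRight hγ' h')
  exfalso
  have hz : γ • UpperHalfPlane.I ∈ pathSet γ := ⟨_, UpperHalfPlane.I_re, rfl⟩
  have hz' := mem_pathSet_pathReverse.mpr hz
  have hF' : γ • UpperHalfPlane.I ∈ closure (interior F) := by
    rw [hF.closure_interior]; exact hF.frontier_subset (hγ hz)
  obtain ⟨O, hO, hzO, hOs⟩ := mem_nhdsWithin.mp (triangleRight_mem_nhdsWithin hz)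
  obtain ⟨O', hO', hzO', hOs'⟩ := mem_nhdsWithin.mp (triangleRight_mem_nhdsWithin hz')
  obtain ⟨w, ⟨hw, hw'⟩, hwF⟩ := mem_closure_iff.mp hF' _ (hO.inter hO') ⟨hzO, hzO'⟩
  rcases mem_rightSide_or_mem_pathSet_or γ w with h1 | h1 | h1
  · exact Set.disjoint_left.mp h (hOs ⟨hw, h1⟩) (interior_subset hwF)
  · exact (hγ h1).2 hwF
  · exact Set.disjoint_left.mp h' (hOs' ⟨hw', h1⟩) (interior_subset hwF)

theorem triangle_nonempty : triangle.Nonempty := by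
  refine ⟨⟨⟨1 / 2, 1⟩, by norm_num⟩, ?_, ?_, ?_⟩
  · change (0 : ℝ) < 1 / 2; norm_num
  · change (1 / 2 : ℝ) < 1; norm_num
  · change (1 / 2 : ℝ) < (1 / 2) ^ 2 + 1 ^ 2; norm_num

theorem triangleRight_nonempty (γ : PSL(2, ℤ)) : (triangleRight γ).Nonempty := by
  rw [triangleRight_eq_image]; exact triangle_nonempty.image _

/-- The interior is connected, does not meet the edge, and contains the triangle to its right. -/
theorem interior_subset_rightSide (hF : IsUnimodularDomain Γ F) {γ : PSL(2, ℤ)}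
    (hγ : γ ∈ orientedBoundary F) : interior F ⊆ rightSide γ := by
  refine hF.isConnected_interior.isPreconnected.subset_left_of_subset_union (isOpen_rightSide γ)
    (isOpen_rightSide (pathReverse γ)) ?_ ?_ ?_
  · rw [Set.disjoint_left]
    intro z h1 h2
    rw [mem_rightSide_pathReverse] at h2
    rw [mem_rightSide] at h1
    exact lt_asymm h1 h2
  · intro z hz
    rcases mem_rightSide_or_mem_pathSet_or γ z with h | h | h
    · exact Or.inl h
    · exact absurd hz (hγ.1 h).2
    · exact Or.inr h
  · obtain ⟨z, hz⟩ := triangleRight_nonempty γ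
    exact ⟨z, hF.triangleRight_subset hγ hz, triangleRight_subset_rightSide γ hz⟩

theorem re_nonneg (hF : IsUnimodularDomain Γ F) {γ : PSL(2, ℤ)} (hγ : γ ∈ orientedBoundary F)
    {z : ℍ} (hz : z ∈ F) : 0 ≤ (γ⁻¹ • z).re := by
  have hc : IsClosed {z : ℍ | 0 ≤ (γ⁻¹ • z).re} := isClosed_le continuous_const (continuous_re_smul _)
  rw [← hF.closure_interior] at hz
  exact closure_minimal (fun w hw => (mem_rightSide.mp (hF.interior_subset_rightSide hγ hw)).le)
    hc hz

theorem pathReverse_notMem (hF : IsUnimodularDomain Γ F) {γ : PSL(2, ℤ)}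
    (hγ : γ ∈ orientedBoundary F) : pathReverse γ ∉ orientedBoundary F := by
  intro h
  obtain ⟨z, hz⟩ := triangleRight_nonempty γ
  have h1 := hF.triangleRight_subset hγ hz
  have h2 := mem_rightSide_pathReverse.mp (hF.interior_subset_rightSide h h1)
  exact absurd h2 (not_lt.mpr (hF.re_nonneg hγ (interior_subset h1)))

theorem exists_mem_orientedBoundary (hF : IsUnimodularDomain Γ F) {z : ℍ} (hz : z ∈ frontier F) :
    ∃ γ ∈ orientedBoundary F, z ∈ pathSet γ := by
  obtain ⟨S, hS⟩ := hF.frontier_eq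
  have hz' := hz
  rw [hS] at hz'
  simp only [Set.mem_iUnion] at hz'
  obtain ⟨γ, hγ, hzγ⟩ := hz'
  have : pathSet γ ⊆ frontier F := by
    rw [hS]; exact Set.subset_biUnion_of_mem hγ
  rcases hF.mem_orientedBoundary_or this with h | h
  · exact ⟨γ, h, hzγ⟩
  · exact ⟨_, h, mem_pathSet_pathReverse.mpr hzγ⟩

end IsUnimodularDomain

/-! ### Vertical paths and boundary arcs -/

theorem exists_eq_T_zpow {γ : PSL(2, ℤ)} (h : γ • (∞ : P1Q) = ∞) :
    ∃ n : ℤ, γ = toPSL ModularGroup.T ^ n := by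
  obtain ⟨A, rfl⟩ := toPSL_surjective γ
  have h' := h
  rw [toPSL_smul_infty] at h'
  have hc : A 1 0 = 0 := by
    by_contra hc
    rw [if_neg (by exact_mod_cast hc)] at h'
    exact OnePoint.coe_ne_infty _ h'
  obtain ⟨n, hn⟩ := ModularGroup.exists_eq_T_zpow_of_c_eq_zero hc
  refine ⟨n, ?_⟩
  -- The sign of the matrix is lost in `PSL₂(ℤ)`, and the available identity concerns actions on
  -- `ℍ`. An element fixing `i` is `1` or the class of `S`, and `S` moves `∞`.
  have hfix : ((toPSL ModularGroup.T ^ n)⁻¹ * toPSL A) • UpperHalfPlane.I = UpperHalfPlane.I := by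
    rw [mul_smul, ← map_zpow, toPSL_smul_upperHalfPlane, hn, ← toPSL_smul_upperHalfPlane,
      inv_smul_smul]
  rcases eq_one_or_S_of_re_eq_zero UpperHalfPlane.I_re
    (by rw [hfix]; exact UpperHalfPlane.I_re) with h1 | h1
  · exact (inv_mul_eq_one.mp h1).symm
  · exfalso
    have h2 : (toPSL ModularGroup.T ^ n)⁻¹ • (∞ : P1Q) = ∞ := by
      rw [← MulAction.mem_stabilizer_iff]
      exact inv_mem (zpow_mem T_smul_infty n)
    have h3 : ((toPSL ModularGroup.T ^ n)⁻¹ * toPSL A) • (∞ : P1Q) = ∞ := by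
      rw [mul_smul, h, h2]
    rw [h1, S_smul_infty] at h3
    exact OnePoint.coe_ne_infty _ h3

theorem T_zpow_smul (n : ℤ) (z : ℍ) : toPSL ModularGroup.T ^ n • z = (n : ℝ) +ᵥ z := by
  rw [← map_zpow, toPSL_smul_upperHalfPlane, UpperHalfPlane.modular_T_zpow_smul]

theorem T_zpow_smul_infty (n : ℤ) : toPSL ModularGroup.T ^ n • (∞ : P1Q) = ∞ := by
  rw [← MulAction.mem_stabilizer_iff]
  exact zpow_mem T_smul_infty n

theorem mem_pathSet_pathInfty {z : ℍ} : z ∈ pathSet pathInfty ↔ z.re = 1 := by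
  rw [mem_pathSet]
  obtain ⟨k, hk, h⟩ := pathInfty_inv_smul_re z
  rw [h, mul_eq_zero, or_iff_right hk.ne', sub_eq_zero, eq_comm]

theorem mem_pathSet_one {z : ℍ} : z ∈ pathSet 1 ↔ z.re = 0 := by
  rw [mem_pathSet]; simp

/-- `e` runs from `p` to `q`, where `0 ≤ q < p ≤ 1`. -/
structure IsClockwiseArc (e : PSL(2, ℤ)) (p q : ℚ) : Prop where
  zero : e • ((0 : ℚ) : P1Q) = p
  infty : e • (∞ : P1Q) = q
  lt : q < p
  nonneg : 0 ≤ q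
  le_one : p ≤ 1
  re : ∀ z : ℍ, ∃ k : ℝ, 0 < k ∧ (e⁻¹ • z).re = k * (z.im ^ 2 + (z.re - p) * (z.re - q))
  inv_infty : ∃ w : ℚ, e⁻¹ • (∞ : P1Q) = w ∧ 0 < w
  inv_coe : ∀ v : ℚ, v ≠ q → ∃ (w k : ℚ), e⁻¹ • (v : P1Q) = w ∧ 0 < k ∧
        w = k * ((v - p) * (v - q))

namespace IsUnimodularDomain

variable {Γ : Subgroup PSL(2, ℤ)} {F : Set ℍ}

theorem eq_or_eq_pathReverse_of_smul_infty (hF : IsUnimodularDomain Γ F) {γ : PSL(2, ℤ)}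
    (hγ : pathSet γ ⊆ F) (h : γ • (∞ : P1Q) = ∞) :
    (γ = 1 ∨ γ = pathReverse 1) ∨ (γ = pathInfty ∨ γ = pathReverse pathInfty) := by
  obtain ⟨n, rfl⟩ := exists_eq_T_zpow h
  have hz : toPSL ModularGroup.T ^ n • UpperHalfPlane.I ∈ pathSet (toPSL ModularGroup.T ^ n) :=
    ⟨_, UpperHalfPlane.I_re, rfl⟩
  have hre : (toPSL ModularGroup.T ^ n • UpperHalfPlane.I).re = n := by rw [T_zpow_smul]; simp
  obtain ⟨h0, h1⟩ := hF.re_mem _ (hγ hz)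
  rw [hre] at h0 h1
  have h0' : (0 : ℤ) ≤ n := by exact_mod_cast h0
  have h1' : n ≤ 1 := by exact_mod_cast h1
  rcases (by omega : n = 0 ∨ n = 1) with rfl | rfl
  · left
    exact eq_or_eq_pathReverse (mem_pathSet_one.mpr (by simp)) hz
  · right
    exact eq_or_eq_pathReverse (mem_pathSet_pathInfty.mpr (by simpa using hre)) hz

theorem pathInfty_inv_infty : pathInfty⁻¹ • (∞ : P1Q) = ((0 : ℚ) : P1Q) := by
  obtain ⟨h1, h2, h3, h4⟩ := TS_inv_entries
  rw [pathInfty, ← map_inv, toPSL_smul_infty, h1, h3]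
  simp

theorem pathInfty_inv_coe {v : ℚ} (hv : v ≠ 1) :
    pathInfty⁻¹ • (v : P1Q) = ((1 / (1 - v) : ℚ) : P1Q) := by
  obtain ⟨h1, h2, h3, h4⟩ := TS_inv_entries
  rw [pathInfty, ← map_inv, toPSL_smul_coe, h1, h2, h3, h4, if_neg]
  · simp; ring
  · simp
    intro h
    apply hv
    linarith

theorem mem_Icc_of_cuspNonneg {v : ℚ} (h1 : CuspNonneg ((1 : PSL(2, ℤ))⁻¹ • (v : P1Q)))
    (h2 : CuspNonneg (pathInfty⁻¹ • (v : P1Q))) : 0 ≤ v ∧ v ≤ 1 := by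
  refine ⟨h1 v (by simp), ?_⟩
  by_contra! hv
  rw [pathInfty_inv_coe hv.ne'] at h2
  have := h2 _ rfl
  rw [one_div, inv_nonneg] at this
  linarith

/-- The only vertical paths in the strip are its two sides. Any other boundary path has rational
ends, which lie in `[0, 1]` because it does not cross these sides. The point `1/2 + 2i` is in the
interior of `F`, so it lies to the right; this fixes the orientation. -/
theorem exists_isClockwiseArc (hF : IsUnimodularDomain Γ F)
    (h1 : pathInftyStar ∈ orientedBoundary F) (hI : pathInfty ∈ orientedBoundary F)
    {e : PSL(2, ℤ)} (he : e ∈ orientedBoundary F) (he1 : e ≠ pathInftyStar) (heI : e ≠ pathInfty) :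
    ∃ p q : ℚ, IsClockwiseArc e p q := by
  have hsub : pathSet e ⊆ F := he.1.trans hF.frontier_subset
  have ne : ∀ γ, (γ = e ∨ γ = pathReverse e) → γ • (∞ : P1Q) ≠ ∞ := by
    intro γ hγ hinf
    have hs : pathSet γ ⊆ F := by
      rcases hγ with rfl | rfl
      · exact hsub
      · exact fun z hz => hsub (mem_pathSet_pathReverse.mp hz)
    have h1' := hF.pathReverse_notMem h1
    have hI' := hF.pathReverse_notMem hI
    have he' := hF.pathReverse_notMem he
    rcases hγ with rfl | rfl
    · rcases hF.eq_or_eq_pathReverse_of_smul_infty hs hinf with (h | h) | (h | h)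
      · exact he1 h
      · exact h1' (h ▸ he)
      · exact heI h
      · exact hI' (h ▸ he)
    · rcases hF.eq_or_eq_pathReverse_of_smul_infty hs hinf with (h | h) | (h | h)
      · exact he' (h ▸ h1)
      · apply he1
        rw [← pathReverse_pathReverse e, h, pathReverse_pathReverse]; rfl
      · exact he' (h ▸ hI)
      · apply heI
        rw [← pathReverse_pathReverse e, h, pathReverse_pathReverse]
  obtain ⟨p, q, hp, hq, hne, hre, ⟨w, hw, hwpos⟩, hv⟩ := exists_endpoints e (ne e (Or.inl rfl)) (by
    have := ne _ (Or.inr rfl)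
    rwa [pathReverse, mul_smul, S_smul_infty] at this)
  have hz : e • UpperHalfPlane.I ∈ pathSet e := ⟨_, UpperHalfPlane.I_re, rfl⟩
  have hA := cuspNonneg_of_re_nonneg hz (hF.re_nonneg h1 (hsub hz))
  have hB := cuspNonneg_of_re_nonneg hz (hF.re_nonneg hI (hsub hz))
  rw [hp, hq] at hA hB
  obtain ⟨hp0, hp1⟩ := mem_Icc_of_cuspNonneg hA.2 hB.2
  obtain ⟨hq0, hq1⟩ := mem_Icc_of_cuspNonneg hA.1 hB.1
  have hlt : q < p := by
    obtain ⟨u, hu⟩ : ∃ u : ℍ, u.re = 1 / 2 ∧ u.im = 2 := ⟨⟨⟨1 / 2, 2⟩, by norm_num⟩, rfl, rfl⟩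
    have hu' : u ∈ triangleRight pathInftyStar := by
      change (1 : PSL(2, ℤ))⁻¹ • u ∈ triangle
      rw [inv_one, one_smul]
      refine ⟨?_, ?_, ?_⟩ <;> rw [hu.1] <;> norm_num
      rw [hu.2]; norm_num
    have hpos := mem_rightSide.mp (hF.interior_subset_rightSide he (hF.triangleRight_subset h1 hu'))
    obtain ⟨k, hk, h⟩ := hre u
    have : 0 < (e⁻¹ • u).re * (p - q) := by
      rw [h, hu.1, hu.2]
      apply mul_pos hk
      have a1 : (0 : ℝ) ≤ p := by exact_mod_cast hp0
      have a2 : (0 : ℝ) ≤ q := by exact_mod_cast hq0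
      have a3 : (p : ℝ) ≤ 1 := by exact_mod_cast hp1
      have a4 : (q : ℝ) ≤ 1 := by exact_mod_cast hq1
      nlinarith
    have h3 := pos_of_mul_pos_right this hpos.le
    have : (q : ℝ) < p := by linarith
    exact_mod_cast this
  have hpq : 0 < p - q := by linarith
  refine ⟨p, q, hp, hq, hlt, hq0, hp1, ?_, ⟨w, hw, pos_of_mul_pos_left hwpos hpq.le⟩, ?_⟩
  · intro z
    obtain ⟨k, hk, h⟩ := hre z
    have hpq' : (0 : ℝ) < p - q := by exact_mod_cast hpq
    refine ⟨k / (p - q), by positivity, ?_⟩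
    field_simp
    linarith
  · intro v hvq
    obtain ⟨w, k, h1, h2, h3⟩ := hv v hvq
    refine ⟨w, k / (p - q), h1, by positivity, ?_⟩
    field_simp
    linarith

end IsUnimodularDomain

namespace IsClockwiseArc

variable {e : PSL(2, ℤ)} {p q : ℚ}

theorem mem_pathSet_iff (h : IsClockwiseArc e p q) {z : ℍ} :
    z ∈ pathSet e ↔ z.im ^ 2 + (z.re - p) * (z.re - q) = 0 := by
  obtain ⟨k, hk, h⟩ := h.re z
  rw [mem_pathSet, h, mul_eq_zero, or_iff_right hk.ne']

theorem mem_rightSide_iff (h : IsClockwiseArc e p q) {z : ℍ} :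
    z ∈ rightSide e ↔ 0 < z.im ^ 2 + (z.re - p) * (z.re - q) := by
  obtain ⟨k, hk, h⟩ := h.re z
  rw [mem_rightSide, h, mul_pos_iff_of_pos_left hk]

theorem re_nonneg_iff (h : IsClockwiseArc e p q) {z : ℍ} :
    0 ≤ (e⁻¹ • z).re ↔ 0 ≤ z.im ^ 2 + (z.re - p) * (z.re - q) := by
  obtain ⟨k, hk, h⟩ := h.re z
  rw [h, mul_nonneg_iff_of_pos_left hk]

/-- A rational number is enclosed by the arc if and only if it lies on its left. -/
theorem inv_smul_neg_iff (h : IsClockwiseArc e p q) {v : ℚ} :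
    ¬ CuspNonneg (e⁻¹ • (v : P1Q)) ↔ q < v ∧ v < p := by
  unfold CuspNonneg
  push Not
  constructor
  · rintro ⟨w, hw, hneg⟩
    have hvq : v ≠ q := by
      rintro rfl
      rw [← h.infty, inv_smul_smul] at hw
      exact OnePoint.infty_ne_coe _ hw
    obtain ⟨w', k, h1, h2, h3⟩ := h.inv_coe v hvq
    rw [hw, OnePoint.coe_eq_coe] at h1
    subst h1
    rw [h3] at hneg
    have h4 : (v - p) * (v - q) < 0 := neg_of_mul_neg_right hneg h2.le
    have := h.lt
    constructor <;> nlinarith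
  · rintro ⟨h1, h2⟩
    obtain ⟨w', k, h3, h4, h5⟩ := h.inv_coe v h1.ne'
    refine ⟨w', h3, ?_⟩
    rw [h5]
    exact mul_neg_of_pos_of_neg h4 (mul_neg_of_neg_of_pos (by linarith) (by linarith))

end IsClockwiseArc

/-! ### Vertical geodesics over the cusps equivalent to infinity -/

/-- Both vertical lines are the geodesics joining `∞` to a rational cusp; `g` carries one to the
other and swaps the roles of the ends. -/
theorem exists_smul_vertical {g : PSL(2, ℤ)} {c : ℚ} (hg : g • (∞ : P1Q) = c) :
    ∃ r : ℚ, g⁻¹ • (∞ : P1Q) = r ∧ ∀ z : ℍ, z.re = r → (g • z).re = c := by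
  obtain ⟨A, rfl⟩ := toPSL_surjective g
  rw [toPSL_smul_infty] at hg
  have hc : (A 1 0 : ℚ) ≠ 0 := by
    rintro hc
    rw [if_pos hc] at hg
    exact OnePoint.infty_ne_coe _ hg
  rw [if_neg hc, OnePoint.coe_eq_coe] at hg
  have i00 : A⁻¹ 0 0 = A 1 1 := by simp [Matrix.SpecialLinearGroup.SL2_inv_expl]
  have i10 : A⁻¹ 1 0 = -A 1 0 := by simp [Matrix.SpecialLinearGroup.SL2_inv_expl]
  refine ⟨-(A 1 1 / A 1 0 : ℚ), ?_, ?_⟩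
  · rw [← map_inv, toPSL_smul_infty, i00, i10, if_neg (by simpa using hc)]
    congr 1
    push_cast
    rw [div_neg]
  · intro z hz
    have hc' : (A 1 0 : ℝ) ≠ 0 := by exact_mod_cast hc
    have hy := z.im_ne_zero
    have h0 : (A 1 0 : ℝ) * z.re + A 1 1 = 0 := by
      rw [hz]; push_cast; field_simp; ring
    have hd : (A 1 1 : ℝ) = -(A 1 0 * z.re) := by linarith
    rw [(re_toPSL_smul A z).2, h0, ← hg, hd]
    push_cast
    field_simp
    ring

theorem exists_upperHalfPlane (x : ℝ) {y : ℝ} (hy : 0 < y) : ∃ z : ℍ, z.re = x ∧ z.im = y :=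
  ⟨⟨⟨x, y⟩, hy⟩, rfl, rfl⟩

theorem pathInfty_pow_three : pathInfty * pathInfty * pathInfty = 1 := by
  rw [pathInfty, ← map_mul, ← map_mul, ← map_one toPSL, ← toPSL_neg 1]
  congr 1
  ext i j
  fin_cases i <;> fin_cases j <;> decide

theorem pathInfty_inv_smul_mem_triangle {z : ℍ} (hz : z ∈ triangle) :
    pathInfty⁻¹ • z ∈ triangle := by
  obtain ⟨h1, h2, h3⟩ := hz
  obtain ⟨k, hk, e⟩ := pathInfty_inv_smul_re z
  obtain ⟨k1, hk1, e1⟩ := pathInfty_inv_sq_smul_re z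
  obtain ⟨k2, hk2, e2⟩ := pathInfty_inv_smul_re (pathInfty⁻¹ • z)
  obtain ⟨k3, hk3, e3⟩ := pathInfty_inv_sq_smul_re (pathInfty⁻¹ • z)
  have h4 : pathInfty⁻¹ • pathInfty⁻¹ • pathInfty⁻¹ • z = z := by
    rw [← mul_smul, ← mul_smul, ← mul_inv_rev, ← mul_inv_rev, ← mul_assoc, pathInfty_pow_three,
      inv_one, one_smul]
  rw [h4] at e3
  refine ⟨?_, ?_, ?_⟩
  · rw [e]; exact mul_pos hk (by linarith)
  · rw [e2] at e1
    have : 0 < k2 * (1 - (pathInfty⁻¹ • z).re) := by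
      rw [e1]; exact mul_pos hk1 (by linarith)
    have := pos_of_mul_pos_right this hk2.le
    linarith
  · rw [e3] at h1
    have := pos_of_mul_pos_right h1 hk3.le
    linarith

namespace IsUnimodularDomain

variable {Γ : Subgroup PSL(2, ℤ)} {F : Set ℍ}

theorem triangle_subset (hF : IsUnimodularDomain Γ F) (h1 : pathInftyStar ∈ orientedBoundary F) :
    triangle ⊆ interior F := by
  intro z hz
  apply hF.triangleRight_subset h1
  change (1 : PSL(2, ℤ))⁻¹ • z ∈ triangle
  simpa using hz

/-- The hypothesis `h` says that no arc passes over `x` at a height above `s`. So the ray misses the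
frontier, and its high points lie in the triangle `0, 1, ∞`. -/
theorem vertical_subset_interior (hF : IsUnimodularDomain Γ F)
    (h1 : pathInftyStar ∈ orientedBoundary F) (hI : pathInfty ∈ orientedBoundary F)
    {x s : ℝ} (hx0 : 0 < x) (hx1 : x < 1)
    (h : ∀ e ∈ orientedBoundary F, ∀ p q : ℚ, IsClockwiseArc e p q → 0 ≤ s ^ 2 + (x - p) * (x - q))
    (hs : 0 ≤ s) : {z : ℍ | z.re = x ∧ s < z.im} ⊆ interior F := by
  refine IsPreconnected.subset_interior_of_disjoint_frontier (isPreconnected_vertical x s hs) ?_ ?_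
  · obtain ⟨z, hz, hz'⟩ := exists_upperHalfPlane x (by linarith : 0 < s + 1)
    refine ⟨z, ⟨hz, by linarith⟩, interior_subset (hF.triangle_subset h1 ⟨?_, ?_, ?_⟩)⟩
    · rwa [hz]
    · rwa [hz]
    · rw [hz, hz']; nlinarith
  · rw [Set.disjoint_left]
    rintro w ⟨hw, hws⟩ hwF
    obtain ⟨e, he, hwe⟩ := hF.exists_mem_orientedBoundary hwF
    by_cases e1 : e = pathInftyStar
    · rw [e1] at hwe
      have := mem_pathSet_one.mp hwe
      linarith
    by_cases eI : e = pathInfty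
    · rw [eI] at hwe
      have := mem_pathSet_pathInfty.mp hwe
      linarith
    obtain ⟨p, q, ha⟩ := hF.exists_isClockwiseArc h1 hI he e1 eI
    have h2 := ha.mem_pathSet_iff.mp hwe
    have h3 := h e he p q ha
    rw [hw] at h2
    nlinarith

/-- The points of `F` over an arc of the boundary. -/
theorem mem_interior_of_mem_rightSide (hF : IsUnimodularDomain Γ F)
    (h1 : pathInftyStar ∈ orientedBoundary F) (hI : pathInfty ∈ orientedBoundary F)
    {e : PSL(2, ℤ)} (he : e ∈ orientedBoundary F) {p q : ℚ} (ha : IsClockwiseArc e p q)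
    {z : ℍ} (hq : q < z.re) (hp : z.re < p) (hz : z ∈ rightSide e) : z ∈ interior F := by
  have hz' := ha.mem_rightSide_iff.mp hz
  have hpos : 0 < (p - z.re) * (z.re - q) := mul_pos (by linarith) (by linarith)
  have hq0 : (0 : ℝ) ≤ q := by exact_mod_cast ha.nonneg
  have hp1 : (p : ℝ) ≤ 1 := by exact_mod_cast ha.le_one
  refine hF.vertical_subset_interior h1 hI (x := z.re) (s := √((p - z.re) * (z.re - q)))
    (by linarith) (by linarith) ?_ (Real.sqrt_nonneg _) ⟨rfl, ?_⟩
  -- The point `w` of `e` over `z.re` belongs to `F`, hence lies weakly to the right of every other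
  -- arc: none passes higher there.
  · intro e' he' p' q' ha'
    obtain ⟨w, hw, hw'⟩ := exists_upperHalfPlane z.re (Real.sqrt_pos.mpr hpos)
    have hwe : w ∈ pathSet e := by
      rw [ha.mem_pathSet_iff, hw, hw', Real.sq_sqrt hpos.le]; ring
    have := ha'.re_nonneg_iff.mp (hF.re_nonneg he' (hF.frontier_subset (he.1 hwe)))
    rwa [hw, hw'] at this
  · rw [Real.sqrt_lt' z.im_pos]
    linarith

theorem mem_of_re_mem_Ico (hF : IsUnimodularDomain Γ F)
    (h1 : pathInftyStar ∈ orientedBoundary F) {z : ℍ} (h0 : 0 ≤ z.re) (hz1 : z.re < 1)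
    (hz : 1 < z.im) : z ∈ F := by
  rcases h0.eq_or_lt with h | h
  · exact hF.frontier_subset (h1.1 (mem_pathSet_one.mpr h.symm))
  · exact interior_subset (hF.triangle_subset h1 ⟨h, hz1, by nlinarith⟩)

/-- Otherwise the whole vertical line over `c` is interior to `F`. Its image under `g⁻¹` is again
vertical, and a translation brings a high point of it into `F`. So `g` is a power of `T`, which
fixes `∞`. -/
theorem exists_isClockwiseArc_of_smul_infty (hF : IsUnimodularDomain Γ F)
    (h1 : pathInftyStar ∈ orientedBoundary F) (hI : pathInfty ∈ orientedBoundary F)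
    (hT : toPSL ModularGroup.T ∈ Γ) {g : PSL(2, ℤ)} (hg : g ∈ Γ) {c : ℚ}
    (hgc : g • (∞ : P1Q) = c) (h0c : 0 < c) (hc1 : c < 1) :
    ∃ e ∈ orientedBoundary F, ∃ p q : ℚ, IsClockwiseArc e p q ∧ q < c ∧ c < p := by
  by_contra! hcon
  have hc0' : (0 : ℝ) < c := by exact_mod_cast h0c
  have hc1' : (c : ℝ) < 1 := by exact_mod_cast hc1
  have hL := hF.vertical_subset_interior h1 hI (x := c) (s := 0) hc0' hc1' (by
    intro e he p q ha
    have h2 : ¬ (q < c ∧ c < p) := fun h => absurd (hcon e he p q ha h.1) (not_le.mpr h.2)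
    have h3 : 0 ≤ (c - p) * (c - q) := by
      have := ha.lt
      rcases le_or_gt c q with h | h
      · exact mul_nonneg_of_nonpos_of_nonpos (by linarith) (by linarith)
      · exact mul_nonneg (by linarith [not_lt.mp fun h' => h2 ⟨h, h'⟩]) (by linarith)
    have h4 : (0 : ℝ) ≤ (c - p) * (c - q) := by exact_mod_cast h3
    linarith) le_rfl
  obtain ⟨r, hr, hv⟩ := exists_smul_vertical hgc
  obtain ⟨w, hw, hw'⟩ := exists_upperHalfPlane r (two_pos)
  have hz : g • w ∈ interior F := hL ⟨hv w hw, (g • w).im_pos⟩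
  have hmem : toPSL ModularGroup.T ^ (-⌊(r : ℝ)⌋) • w ∈ F := by
    rw [T_zpow_smul]
    apply hF.mem_of_re_mem_Ico h1
    · simp only [UpperHalfPlane.vadd_re, hw]
      push_cast
      linarith [Int.floor_le (r : ℝ)]
    · simp only [UpperHalfPlane.vadd_re, hw]
      push_cast
      linarith [Int.lt_floor_add_one (r : ℝ)]
    · simp [hw']
  have := hF.eq_one_of_mem (mul_mem hg (zpow_mem hT ⌊(r : ℝ)⌋)) hz (by
    rwa [mul_inv_rev, mul_smul, inv_smul_smul, ← zpow_neg])
  have h5 : (g * toPSL ModularGroup.T ^ ⌊(r : ℝ)⌋) • (∞ : P1Q) = c := by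
    rw [mul_smul, T_zpow_smul_infty, hgc]
  rw [this, one_smul] at h5
  exact OnePoint.infty_ne_coe _ h5

/-- `δ` differs from `g` by a power of `T`, so it lies in `Γ`. It moves a point of the triangle in
`F` into the interior of `F`, hence is `1`. -/
theorem eq_infty_of_smul_infty_eq (hF : IsUnimodularDomain Γ F)
    (h1 : pathInftyStar ∈ orientedBoundary F) (hT : toPSL ModularGroup.T ∈ Γ) {g δ : PSL(2, ℤ)}
    (hg : g ∈ Γ) (hδ : δ • (∞ : P1Q) = g • ∞) (h : ∃ z ∈ triangle, δ • z ∈ interior F) :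
    δ • (∞ : P1Q) = ∞ := by
  obtain ⟨n, hn⟩ := exists_eq_T_zpow (γ := g⁻¹ * δ) (by rw [mul_smul, hδ, inv_smul_smul])
  obtain ⟨z, hz, hz'⟩ := h
  have hδ' : δ = g * toPSL ModularGroup.T ^ n := by rw [← hn]; group
  have hδΓ : δ ∈ Γ := hδ' ▸ mul_mem hg (zpow_mem hT n)
  rw [hF.eq_one_of_mem hδΓ hz'
    (by rw [inv_smul_smul]; exact interior_subset (hF.triangle_subset h1 hz)), one_smul]

/-- The end points of a boundary arc are not equivalent to `∞`. -/
theorem smul_notMem_orbit (hF : IsUnimodularDomain Γ F)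
    (h1 : pathInftyStar ∈ orientedBoundary F) (hT : toPSL ModularGroup.T ∈ Γ) {e : PSL(2, ℤ)}
    (he : e ∈ orientedBoundary F) {p q : ℚ} (ha : IsClockwiseArc e p q) {g : PSL(2, ℤ)}
    (hg : g ∈ Γ) : (p : P1Q) ≠ g • ∞ ∧ (q : P1Q) ≠ g • ∞ := by
  obtain ⟨z, hz⟩ := triangle_nonempty
  have hsub : ∀ w ∈ triangle, e • w ∈ interior F := fun w hw =>
    hF.triangleRight_subset he (by rw [triangleRight_eq_image]; exact ⟨w, hw, rfl⟩)
  constructor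
  · intro h
    have h0 : (e * pathInfty⁻¹) • (∞ : P1Q) = p := by
      rw [mul_smul, pathInfty_inv_infty, ha.zero]
    have := hF.eq_infty_of_smul_infty_eq h1 hT (δ := e * pathInfty⁻¹) hg (h0.trans h)
      ⟨z, hz, by rw [mul_smul]; exact hsub _ (pathInfty_inv_smul_mem_triangle hz)⟩
    rw [h0] at this
    exact OnePoint.coe_ne_infty _ this
  · intro h
    have := hF.eq_infty_of_smul_infty_eq h1 hT (δ := e) hg (ha.infty.trans h) ⟨z, hz, hsub z hz⟩
    rw [ha.infty] at this
    exact OnePoint.coe_ne_infty _ this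

/-- If the reversal of the boundary arc `e` is `g` times a boundary arc, then the cusp `g • ∞` is
enclosed by `e`. -/
theorem exists_smul_infty_of_pathReverse_eq {e e' : PSL(2, ℤ)} {p q p' q' : ℚ}
    (ha : IsClockwiseArc e p q) (ha' : IsClockwiseArc e' p' q') {g : PSL(2, ℤ)}
    (h : pathReverse e = g * e') : ∃ c : ℚ, g • (∞ : P1Q) = c ∧ q < c ∧ c < p := by
  obtain ⟨w, hw, hwpos⟩ := ha'.inv_infty
  -- `∞` lies to the right of `e'`, at a positive `w` in its coordinate; reversal by `S` makes this
  -- negative, so `g • ∞` is on the left of `e`.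
  have h1 : e⁻¹ • g • (∞ : P1Q) = ((-w⁻¹ : ℚ) : P1Q) := by
    have : e⁻¹ * g = toPSL ModularGroup.S * e'⁻¹ := by
      rw [eq_mul_inv_iff_mul_eq, mul_assoc, ← h, pathReverse, inv_mul_cancel_left]
    rw [← mul_smul, this, mul_smul, hw, S_smul_coe hwpos.ne']
  have hneg : ¬ CuspNonneg (e⁻¹ • g • (∞ : P1Q)) := by
    intro hn
    have := hn _ h1
    have := inv_pos.mpr hwpos
    linarith
  obtain hinf | ⟨c, hc⟩ : g • (∞ : P1Q) = ∞ ∨ ∃ c : ℚ, g • (∞ : P1Q) = c := by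
    induction g • (∞ : P1Q) using OnePoint.rec with
    | infty => exact Or.inl rfl
    | coe c => exact Or.inr ⟨c, rfl⟩
  · exfalso
    obtain ⟨w', hw', hw'pos⟩ := ha.inv_infty
    rw [hinf, hw'] at hneg
    apply hneg
    intro u hu
    rw [OnePoint.coe_eq_coe] at hu
    linarith
  · rw [hc] at hneg
    exact ⟨c, hc, ha.inv_smul_neg_iff.mp hneg⟩

theorem eq_one_of_mul_eq (hF : IsUnimodularDomain Γ F) {γ δ δ' : PSL(2, ℤ)} (hγ : γ ∈ Γ)
    (hδ : δ ∈ orientedBoundary F) (hδ' : δ' ∈ orientedBoundary F) (h : γ * δ = δ') : γ = 1 := by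
  obtain ⟨z, hz⟩ := triangleRight_nonempty δ'
  apply hF.eq_one_of_mem hγ (hF.triangleRight_subset hδ' hz)
  apply interior_subset (hF.triangleRight_subset hδ _)
  rw [← smul_mem_triangleRight (g := γ), smul_inv_smul, h]
  exact hz

/-- The geodesic from `∞` to `g • ∞`, where `pathReverse e = g * e'`, meets only one translate of
the boundary arcs of `F`, up to orientation. -/
theorem eq_or_eq_of_separated (hF : IsUnimodularDomain Γ F)
    (h1 : pathInftyStar ∈ orientedBoundary F) (hI : pathInfty ∈ orientedBoundary F)
    {e e' f : PSL(2, ℤ)} (he : e ∈ orientedBoundary F) (he' : e' ∈ orientedBoundary F)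
    (hf : f ∈ orientedBoundary F) {p q p' q' : ℚ} (ha : IsClockwiseArc e p q)
    (ha' : IsClockwiseArc e' p' q') {g γ : PSL(2, ℤ)} (hg : g ∈ Γ) (hγ : γ ∈ Γ)
    (h : pathReverse e = g * e') {c a b : ℚ} (hc : g • (∞ : P1Q) = c)
    (hb : (γ * f) • ((0 : ℚ) : P1Q) = b) (ha0 : (γ * f) • (∞ : P1Q) = a)
    (hsep : (c - a) * (c - b) < 0) : (γ = 1 ∧ f = e) ∨ (γ = g ∧ f = e') := by
  obtain ⟨c', hc', hqc, hcp⟩ := exists_smul_infty_of_pathReverse_eq ha ha' h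
  obtain rfl : c = c' := OnePoint.coe_injective (hc.symm.trans hc')
  have h' : pathReverse e' = g⁻¹ * e := by
    rw [eq_inv_mul_iff_mul_eq, ← mul_pathReverse, ← h, pathReverse_pathReverse]
  obtain ⟨r, hr, hqr, hrp⟩ := exists_smul_infty_of_pathReverse_eq ha' ha h'
  have hvert : ∀ z : ℍ, z.re = c → (g⁻¹ • z).re = r := by
    obtain ⟨c', hc1, hc2⟩ := exists_smul_vertical hr
    rw [inv_inv] at hc1
    obtain rfl : c = c' := OnePoint.coe_injective (hc.symm.trans hc1)
    exact hc2
  obtain ⟨b', a', hb', ha0', hne, hform, -, -⟩ := exists_endpoints (γ * f)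
    (by rw [ha0]; exact OnePoint.coe_ne_infty _) (by rw [hb]; exact OnePoint.coe_ne_infty _)
  obtain rfl : b = b' := OnePoint.coe_injective (hb.symm.trans hb')
  obtain rfl : a = a' := OnePoint.coe_injective (ha0.symm.trans ha0')
  have hsep' : (0 : ℝ) < -(((c : ℝ) - a) * (c - b)) := by
    have : (((c : ℝ) - a) * (c - b)) < 0 := by exact_mod_cast hsep
    linarith
  -- The half circle with ends `a`, `b` on both sides of `c` meets the vertical line over `c` at
  -- this height.
  obtain ⟨z, hz, hz'⟩ := exists_upperHalfPlane c (Real.sqrt_pos.mpr hsep')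
  have hzp : z ∈ pathSet (γ * f) := by
    obtain ⟨k, hk, hkf⟩ := hform z
    rw [hz, hz', Real.sq_sqrt hsep'.le] at hkf
    have h0 : ((γ * f)⁻¹ • z).re * ((b : ℝ) - a) = 0 := by rw [hkf]; ring
    rw [mem_pathSet]
    exact (mul_eq_zero.mp h0).resolve_right (sub_ne_zero.mpr (by exact_mod_cast hne))
  have hzf : γ⁻¹ • z ∈ pathSet f := by
    rwa [← smul_mem_pathSet (g := γ), smul_inv_smul]
  have hzF := hf.1 hzf
  -- Over `c`, points above `e` are interior to `F` and points below `e` are interior to `g F`;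
  -- neither can lie on a translate of the frontier.
  rcases mem_rightSide_or_mem_pathSet_or e z with hR | hP | hL
  · exfalso
    have hint := hF.mem_interior_of_mem_rightSide h1 hI he ha (by rw [hz]; exact_mod_cast hqc)
      (by rw [hz]; exact_mod_cast hcp) hR
    have := hF.eq_one_of_mem hγ hint (hF.frontier_subset hzF)
    rw [this, inv_one, one_smul] at hzF
    exact hzF.2 hint
  · rcases eq_or_eq_pathReverse hP hzp with h2 | h2
    · have := hF.eq_one_of_mul_eq hγ hf he h2
      left
      refine ⟨this, ?_⟩
      rwa [this, one_mul] at h2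
    · rw [h, ← eq_inv_mul_iff_mul_eq, ← mul_assoc, eq_comm] at h2
      have h3 : (γ⁻¹ * g) = 1 := hF.eq_one_of_mul_eq (mul_mem (inv_mem hγ) hg) he' hf h2
      right
      refine ⟨inv_mul_eq_one.mp h3, ?_⟩
      rw [h3, one_mul] at h2
      exact h2.symm
  · exfalso
    rw [h, ← smul_inv_smul g z, smul_mem_rightSide] at hL
    have hint := hF.mem_interior_of_mem_rightSide h1 hI he' ha'
      (by rw [hvert z hz]; exact_mod_cast hqr) (by rw [hvert z hz]; exact_mod_cast hrp) hL
    have := hF.eq_one_of_mem (g := g⁻¹ * γ) (mul_mem (inv_mem hg) hγ) hint (by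
      rw [← mul_smul, mul_inv_rev, inv_inv, mul_assoc, mul_inv_cancel, mul_one]
      exact hF.frontier_subset hzF)
    rw [inv_mul_eq_one] at this
    rw [← this] at hzF
    exact hzF.2 hint

end IsUnimodularDomain

/-! ### Spanning: all cusps away from infinity agree modulo the arcs -/

theorem divRep_single (γ : PSL(2, ℤ)) (v : P1Q) (n : ℤ) :
    divRep γ (Finsupp.single v n) = Finsupp.single (γ • v) n := by
  change Finsupp.mapDomain _ _ = _
  rw [Finsupp.mapDomain_single]

theorem divRep_pathDiv (γ δ : PSL(2, ℤ)) : divRep γ (pathDiv δ) = pathDiv (γ * δ) := by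
  rw [pathDiv, map_sub, divRep_single, divRep_single, pathDiv, mul_smul, mul_smul]

theorem pathDiv_pathReverse (γ : PSL(2, ℤ)) : pathDiv (pathReverse γ) = -pathDiv γ := by
  rw [pathDiv, pathDiv, pathReverse, mul_smul, mul_smul, S_smul_infty, S_smul_zero, neg_sub]

/-- `v` is a rational number in `[0, 1]` that is not enclosed by an arc of the boundary. -/
def IsVertex (F : Set ℍ) (v : ℚ) : Prop :=
  0 ≤ v ∧ v ≤ 1 ∧ ∀ e ∈ orientedBoundary F, ∀ p q : ℚ, IsClockwiseArc e p q → ¬ (q < v ∧ v < p)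

/-- The cusps `g • ∞` with `g ∈ Γ` are dense. -/
def DenseCusps (Γ : Subgroup PSL(2, ℤ)) : Prop :=
  ∀ a b : ℚ, a < b → ∃ g ∈ Γ, ∃ c : ℚ, g • (∞ : P1Q) = c ∧ a < c ∧ c < b

/-- A representative of the cusp `v` away from `∞`, that is, `v` itself unless `v` is equivalent
to `∞`. -/
def cuspBase (Γ : Subgroup PSL(2, ℤ)) (v : P1Q) : P1Q :=
  open Classical in
  if h : ∃ g ∈ Γ, g • (∞ : P1Q) = v then h.choose • ((0 : ℚ) : P1Q) else v

theorem cuspBase_of_notMem {Γ : Subgroup PSL(2, ℤ)} {v : P1Q} (h : ¬ ∃ g ∈ Γ, g • (∞ : P1Q) = v) :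
    cuspBase Γ v = v := dif_neg h

theorem exists_cuspBase_eq {Γ : Subgroup PSL(2, ℤ)} {v : P1Q} (h : ∃ g ∈ Γ, g • (∞ : P1Q) = v) :
    ∃ g ∈ Γ, g • (∞ : P1Q) = v ∧ cuspBase Γ v = g • ((0 : ℚ) : P1Q) :=
  ⟨h.choose, h.choose_spec.1, h.choose_spec.2, dif_pos h⟩

theorem exists_coe_of_ne_infty {v : P1Q} (h : v ≠ ∞) : ∃ w : ℚ, v = w := by
  induction v using OnePoint.rec with
  | infty => exact absurd rfl h
  | coe c => exact ⟨c, rfl⟩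

namespace IsUnimodularDomain

variable {Γ : Subgroup PSL(2, ℤ)} {F : Set ℍ}

theorem isVertex_of_mem (hF : IsUnimodularDomain Γ F)
    (h1 : pathInftyStar ∈ orientedBoundary F) (hI : pathInfty ∈ orientedBoundary F)
    {δ : PSL(2, ℤ)} {z : ℍ} (hz : z ∈ pathSet δ) (hzF : z ∈ F) {v : ℚ}
    (hv : (v : P1Q) = δ • ∞ ∨ (v : P1Q) = δ • ((0 : ℚ) : P1Q)) : IsVertex F v := by
  have key : ∀ γ ∈ orientedBoundary F, CuspNonneg (γ⁻¹ • (v : P1Q)) := by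
    intro γ hγ
    have := cuspNonneg_of_re_nonneg hz (hF.re_nonneg hγ hzF)
    rcases hv with h | h <;> rw [h]
    · exact this.1
    · exact this.2
  obtain ⟨h2, h3⟩ := mem_Icc_of_cuspNonneg (key _ h1) (key _ hI)
  exact ⟨h2, h3, fun e he p q ha => fun h => ha.inv_smul_neg_iff.mpr h (key e he)⟩

theorem isVertex_of_isClockwiseArc (hF : IsUnimodularDomain Γ F)
    (h1 : pathInftyStar ∈ orientedBoundary F) (hI : pathInfty ∈ orientedBoundary F)
    {e : PSL(2, ℤ)} (he : e ∈ orientedBoundary F) {p q : ℚ} (ha : IsClockwiseArc e p q) :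
    IsVertex F q := by
  have hz : e • UpperHalfPlane.I ∈ pathSet e := ⟨_, UpperHalfPlane.I_re, rfl⟩
  exact hF.isVertex_of_mem h1 hI hz (hF.frontier_subset (he.1 hz)) (Or.inl ha.infty.symm)

/-- Let `w` be the largest arc end below `v`, or `0`. Some cusp `g • ∞` lies between `w` and `v`,
below an arc whose right end exceeds `w` and so is at least `v`. As no arc encloses `v`, that end is
`v`. -/
theorem exists_arc_of_isVertex (hF : IsUnimodularDomain Γ F)
    (h1 : pathInftyStar ∈ orientedBoundary F) (hI : pathInfty ∈ orientedBoundary F)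
    (hT : toPSL ModularGroup.T ∈ Γ) (hfin : (orientedBoundary F).Finite) (hdense : DenseCusps Γ)
    {v : ℚ} (hv : IsVertex F v) (hv0 : 0 < v) :
    ∃ e ∈ orientedBoundary F, ∃ q : ℚ, IsClockwiseArc e v q := by
  let X : Set ℚ := {x | ((x : P1Q) ∈ (fun e : PSL(2, ℤ) => e • (∞ : P1Q)) '' orientedBoundary F ∪
    (fun e : PSL(2, ℤ) => e • ((0 : ℚ) : P1Q)) '' orientedBoundary F) ∧ x < v} ∪ {0}
  have hX : X.Finite := by
    refine Set.Finite.union (Set.Finite.subset (Set.Finite.preimage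
      (OnePoint.coe_injective.injOn) ((hfin.image _).union (hfin.image _))) fun x hx => hx.1)
      (Set.finite_singleton _)
  obtain ⟨w, hwX, hw⟩ := Set.exists_max_image X id hX ⟨0, Or.inr rfl⟩
  have hwv : w < v := by
    rcases hwX with h | h
    · exact h.2
    · rw [h]; exact hv0
  have hw0 : 0 ≤ w := hw 0 (Or.inr rfl)
  obtain ⟨g, hg, c, hc, hwc, hcv⟩ := hdense w v hwv
  obtain ⟨e, he, p, q, ha, hqc, hcp⟩ := hF.exists_isClockwiseArc_of_smul_infty h1 hI hT hg hc
    (by linarith) (by linarith [hv.2.1])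
  have hpv : v ≤ p := by
    by_contra! hlt
    have := hw p (Or.inl ⟨Or.inr ⟨e, he, ha.zero⟩, hlt⟩)
    simp only [id] at this
    linarith
  have := hv.2.2 e he p q ha
  have hpv' : p = v := by
    rcases hpv.eq_or_lt with h | h
    · exact h.symm
    · exact absurd ⟨by linarith, h⟩ this
  exact ⟨e, he, q, hpv' ▸ ha⟩

/-- Descent: a smallest bad vertex is the right end of an arc, whose left end is a smaller vertex
and therefore good. Bad vertices are finite in number, being ends of arcs. -/
theorem isVertex_sub_mem (hF : IsUnimodularDomain Γ F)
    (h1 : pathInftyStar ∈ orientedBoundary F) (hI : pathInfty ∈ orientedBoundary F)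
    (hT : toPSL ModularGroup.T ∈ Γ) (hfin : (orientedBoundary F).Finite) (hdense : DenseCusps Γ)
    {D : Submodule ℤ (P1Q →₀ ℤ)}
    (hD : ∀ e ∈ orientedBoundary F, ∀ p q : ℚ, IsClockwiseArc e p q → pathDiv e ∈ D)
    {v : ℚ} (hv : IsVertex F v) :
    Finsupp.single (v : P1Q) (1 : ℤ) - Finsupp.single ((0 : ℚ) : P1Q) 1 ∈ D := by
  by_contra hbad
  let X : Set ℚ := {x | IsVertex F x ∧
    Finsupp.single (x : P1Q) (1 : ℤ) - Finsupp.single ((0 : ℚ) : P1Q) 1 ∉ D}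
  have hpos : ∀ x ∈ X, 0 < x := by
    rintro x ⟨hx, hxD⟩
    rcases hx.1.eq_or_lt with h | h
    · exfalso
      apply hxD
      rw [← h, sub_self]
      exact zero_mem D
    · exact h
  have hX : X.Finite := by
    refine Set.Finite.subset (Set.Finite.preimage (OnePoint.coe_injective.injOn)
      (hfin.image (fun e : PSL(2, ℤ) => e • ((0 : ℚ) : P1Q)))) fun x hx => ?_
    obtain ⟨e, he, q, ha⟩ := hF.exists_arc_of_isVertex h1 hI hT hfin hdense hx.1 (hpos x hx)
    exact ⟨e, he, ha.zero⟩
  obtain ⟨x, hx, hmin⟩ := Set.exists_min_image X id hX ⟨v, hv, hbad⟩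
  obtain ⟨e, he, q, ha⟩ := hF.exists_arc_of_isVertex h1 hI hT hfin hdense hx.1 (hpos x hx)
  have hq : Finsupp.single (q : P1Q) (1 : ℤ) - Finsupp.single ((0 : ℚ) : P1Q) 1 ∈ D := by
    by_contra hqD
    exact absurd ha.lt (not_lt.mpr (hmin q ⟨hF.isVertex_of_isClockwiseArc h1 hI he ha, hqD⟩))
  have hp := hD e he _ _ ha
  rw [pathDiv, ha.zero, ha.infty] at hp
  apply hx.2
  have := sub_mem hq hp
  rwa [sub_sub_sub_cancel_left] at this

theorem notMem_of_isVertex (hF : IsUnimodularDomain Γ F)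
    (h1 : pathInftyStar ∈ orientedBoundary F) (hI : pathInfty ∈ orientedBoundary F)
    (hT : toPSL ModularGroup.T ∈ Γ) (hfin : (orientedBoundary F).Finite) (hdense : DenseCusps Γ)
    {v : ℚ} (hv : IsVertex F v) : ¬ ∃ g ∈ Γ, g • (∞ : P1Q) = v := by
  have pos : ∀ v : ℚ, IsVertex F v → 0 < v → ¬ ∃ g ∈ Γ, g • (∞ : P1Q) = v := by
    rintro v hv hv0 ⟨g, hg, hgv⟩
    obtain ⟨e, he, q, ha⟩ := hF.exists_arc_of_isVertex h1 hI hT hfin hdense hv hv0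
    exact (hF.smul_notMem_orbit h1 hT he ha hg).1 hgv.symm
  rcases hv.1.eq_or_lt with h | h
  · rintro ⟨g, hg, hgv⟩
    -- The vertex `0` is the left end of the strip; `T` moves it to the positive vertex `1`.
    refine pos 1 ⟨zero_le_one, le_rfl, fun e he p q ha h => ?_⟩ one_pos ⟨_, mul_mem hT hg, ?_⟩
    · linarith [ha.le_one, h.2]
    · rw [mul_smul, hgv, ← h, toPSL_smul_coe]
      simp [ModularGroup.T]
  · exact pos v hv h

theorem T_zpow_sub_mem (hF : IsUnimodularDomain Γ F)
    (h1 : pathInftyStar ∈ orientedBoundary F) (hI : pathInfty ∈ orientedBoundary F)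
    (hT : toPSL ModularGroup.T ∈ Γ) (hfin : (orientedBoundary F).Finite) (hdense : DenseCusps Γ)
    {D : Submodule ℤ (P1Q →₀ ℤ)}
    (hD : ∀ e ∈ orientedBoundary F, ∀ p q : ℚ, IsClockwiseArc e p q → pathDiv e ∈ D)
    (hDΓ : ∀ γ ∈ Γ, ∀ x ∈ D, divRep γ x ∈ D) (n : ℤ) :
    Finsupp.single (toPSL ModularGroup.T ^ n • ((0 : ℚ) : P1Q)) (1 : ℤ) -
      Finsupp.single ((0 : ℚ) : P1Q) 1 ∈ D := by
  have hv : IsVertex F 1 :=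
    ⟨zero_le_one, le_rfl, fun e he p q ha h => by linarith [ha.le_one, h.2]⟩
  have hone := hF.isVertex_sub_mem h1 hI hT hfin hdense hD hv
  have hT0 : toPSL ModularGroup.T • ((0 : ℚ) : P1Q) = ((1 : ℚ) : P1Q) := by
    rw [toPSL_smul_coe]; simp [ModularGroup.T]
  have step : ∀ n : ℤ, Finsupp.single (toPSL ModularGroup.T ^ (n + 1) • ((0 : ℚ) : P1Q)) (1 : ℤ) -
      Finsupp.single (toPSL ModularGroup.T ^ n • ((0 : ℚ) : P1Q)) 1 ∈ D := by
    intro n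
    have := hDΓ _ (zpow_mem hT n) _ hone
    rwa [map_sub, divRep_single, divRep_single, ← hT0, ← mul_smul, ← zpow_add_one] at this
  induction n using Int.induction_on with
  | zero => simp
  | succ i hi =>
    have := add_mem (step i) hi
    rwa [sub_add_sub_cancel] at this
  | pred i hi =>
    have := sub_mem hi (step (-i - 1))
    rwa [sub_add_cancel, sub_sub_sub_cancel_left] at this

/-- Two elements with the same value at `∞` differ by a power of `T`, so modulo `D` the choice in
`cuspBase` is harmless and the replacement is equivariant. -/
theorem cuspBase_smul_sub_mem {D : Submodule ℤ (P1Q →₀ ℤ)}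
    (hDΓ : ∀ γ ∈ Γ, ∀ x ∈ D, divRep γ x ∈ D)
    (hDT : ∀ n : ℤ, Finsupp.single (toPSL ModularGroup.T ^ n • ((0 : ℚ) : P1Q)) (1 : ℤ) -
      Finsupp.single ((0 : ℚ) : P1Q) 1 ∈ D) {γ : PSL(2, ℤ)} (hγ : γ ∈ Γ) (v : P1Q) :
    Finsupp.single (cuspBase Γ (γ • v)) (1 : ℤ) -
      divRep γ (Finsupp.single (cuspBase Γ v) 1) ∈ D := by
  by_cases h : ∃ g ∈ Γ, g • (∞ : P1Q) = v
  · obtain ⟨g, hg, hgv, hb⟩ := exists_cuspBase_eq h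
    obtain ⟨g', hg', hgv', hb'⟩ := exists_cuspBase_eq (v := γ • v)
      ⟨γ * g, mul_mem hγ hg, by rw [mul_smul, hgv]⟩
    obtain ⟨n, hn⟩ := exists_eq_T_zpow (γ := (γ * g)⁻¹ * g') (by
      rw [mul_smul, hgv', ← hgv, ← mul_smul γ, inv_smul_smul])
    rw [inv_mul_eq_iff_eq_mul] at hn
    have := hDΓ _ (mul_mem hγ hg) _ (hDT n)
    rw [map_sub, divRep_single, divRep_single, ← mul_smul, ← hn] at this
    rwa [hb, hb', divRep_single, ← mul_smul]
  · rw [cuspBase_of_notMem h, cuspBase_of_notMem, divRep_single, sub_self]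
    · exact zero_mem D
    · rintro ⟨g, hg, hgv⟩
      exact h ⟨γ⁻¹ * g, mul_mem (inv_mem hγ) hg, by rw [mul_smul, hgv, inv_smul_smul]⟩

/-- Modulo the boundary arcs, all cusps not equivalent to `∞` agree. -/
theorem single_sub_single_mem (hF : IsUnimodularDomain Γ F)
    (h1 : pathInftyStar ∈ orientedBoundary F) (hI : pathInfty ∈ orientedBoundary F)
    (hT : toPSL ModularGroup.T ∈ Γ) (hfin : (orientedBoundary F).Finite) (hdense : DenseCusps Γ)
    {D : Submodule ℤ (P1Q →₀ ℤ)}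
    (hD : ∀ e ∈ orientedBoundary F, ∀ p q : ℚ, IsClockwiseArc e p q → pathDiv e ∈ D)
    (hDΓ : ∀ γ ∈ Γ, ∀ x ∈ D, divRep γ x ∈ D) {u v : P1Q}
    (hu : ¬ ∃ g ∈ Γ, g • (∞ : P1Q) = u) (hv : ¬ ∃ g ∈ Γ, g • (∞ : P1Q) = v) :
    Finsupp.single u (1 : ℤ) - Finsupp.single v 1 ∈ D := by
  have hDT := hF.T_zpow_sub_mem h1 hI hT hfin hdense hD hDΓ
  have base_infty : Finsupp.single (cuspBase Γ ∞) (1 : ℤ) - Finsupp.single ((0 : ℚ) : P1Q) 1 ∈ D := by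
    obtain ⟨g, hg, hgv, hb⟩ := exists_cuspBase_eq (Γ := Γ) (v := ∞) ⟨1, one_mem _, one_smul _ _⟩
    obtain ⟨n, rfl⟩ := exists_eq_T_zpow hgv
    rw [hb]
    exact hDT n
  have base_mem : ∀ {δ : PSL(2, ℤ)} {z : ℍ} (_ : z ∈ pathSet δ) (_ : z ∈ F) (x : P1Q)
      (_ : x = δ • ∞ ∨ x = δ • ((0 : ℚ) : P1Q)),
      Finsupp.single (cuspBase Γ x) (1 : ℤ) - Finsupp.single ((0 : ℚ) : P1Q) 1 ∈ D := by
    intro δ z hz hzF x hx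
    by_cases hinf : x = ∞
    · rw [hinf]; exact base_infty
    · obtain ⟨w, rfl⟩ := exists_coe_of_ne_infty hinf
      have hvert := hF.isVertex_of_mem h1 hI hz hzF hx
      rw [cuspBase_of_notMem (hF.notMem_of_isVertex h1 hI hT hfin hdense hvert)]
      exact hF.isVertex_sub_mem h1 hI hT hfin hdense hD hvert
  -- Move the edge by `γ` so that it meets `F`, compare its ends there with `0`, and move back.
  have edge : ∀ δ : PSL(2, ℤ), Finsupp.single (cuspBase Γ (δ • ∞)) (1 : ℤ) -
      Finsupp.single (cuspBase Γ (δ • ((0 : ℚ) : P1Q))) 1 ∈ D := by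
    intro δ
    have hz : δ • UpperHalfPlane.I ∈ pathSet δ := ⟨_, UpperHalfPlane.I_re, rfl⟩
    obtain ⟨γ, hγ, hγF⟩ := hF.exists_smul_mem (δ • UpperHalfPlane.I)
    have hz' := smul_mem_pathSet (g := γ).mpr hz
    have e1 := base_mem hz' hγF _ (Or.inl rfl)
    have e2 := base_mem hz' hγF _ (Or.inr rfl)
    have e3 := cuspBase_smul_sub_mem hDΓ hDT hγ (δ • ∞)
    have e4 := cuspBase_smul_sub_mem hDΓ hDT hγ (δ • ((0 : ℚ) : P1Q))
    rw [mul_smul] at e1 e2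
    have e5 := hDΓ _ (inv_mem hγ) _ (sub_mem (sub_mem e1 e3) (sub_mem e2 e4))
    rw [sub_sub_sub_cancel_left, sub_sub_sub_cancel_left, sub_sub_sub_cancel_right, ← map_sub,
      ← Module.End.mul_apply, ← map_mul, inv_mul_cancel, map_one] at e5
    exact e5
  -- Walk through the Farey graph: appending `T` keeps the cusp `x • ∞`, appending `S` replaces it
  -- by the other end of the edge of `x`.
  have all : ∀ A : SL(2, ℤ), Finsupp.single (cuspBase Γ (toPSL A • ∞)) (1 : ℤ) -
      Finsupp.single (cuspBase Γ ∞) 1 ∈ D := by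
    intro A
    have hA : A ∈ Subgroup.closure {ModularGroup.S, ModularGroup.T} := by
      rw [SpecialLinearGroup.SL2Z_generators]; trivial
    induction hA using Subgroup.closure_induction_right with
    | one => simp
    | mul_right x hx y hy ih =>
      rcases hy with rfl | rfl
      · rw [map_mul, mul_smul, S_smul_infty]
        have := sub_mem ih (edge (toPSL x))
        rwa [sub_sub_sub_cancel_left] at this
      · rwa [map_mul, mul_smul, T_smul_infty]
    | mul_inv_cancel x hx y hy ih =>
      rcases hy with rfl | rfl
      · rw [map_mul, mul_smul, map_inv, toPSL_S_inv, S_smul_infty]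
        have := sub_mem ih (edge (toPSL x))
        rwa [sub_sub_sub_cancel_left] at this
      · rwa [map_mul, mul_smul, map_inv, inv_smul_eq_iff.mpr T_smul_infty.symm]
  have fin : ∀ u : P1Q, (¬ ∃ g ∈ Γ, g • (∞ : P1Q) = u) → Finsupp.single u (1 : ℤ) -
      Finsupp.single (cuspBase Γ ∞) 1 ∈ D := by
    intro u hu
    obtain ⟨A, hA⟩ := u.exists_mem_SL2 ℤ
    have hA' : toPSL A • (∞ : P1Q) = u := hA
    have := all A
    rwa [hA', cuspBase_of_notMem hu] at this
  have := sub_mem (fin u hu) (fin v hv)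
  rwa [sub_sub_sub_cancel_right] at this

end IsUnimodularDomain

/-! ### Translation and density of cusps for `Γ₀(N)` -/

theorem T_mem_PGamma0 (N : ℕ) : toPSL ModularGroup.T ∈ PGamma0 N := by
  refine ⟨_, ?_, rfl⟩
  rw [SetLike.mem_coe, CongruenceSubgroup.Gamma0_mem]
  simp [ModularGroup.T]

theorem denseCusps_PGamma0 {N : ℕ} (hN : N ≠ 0) : DenseCusps (PGamma0 N) := by
  intro a b hab
  obtain ⟨k, hk⟩ := exists_nat_gt (1 / (b - a))
  have hba : 0 < b - a := by linarith
  have hk0 : 0 < (k : ℚ) := lt_trans (by positivity) hk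
  have hN1 : (1 : ℚ) ≤ N := by exact_mod_cast Nat.one_le_iff_ne_zero.mpr hN
  have hL : 1 < (N * k : ℚ) * (b - a) := by
    rw [div_lt_iff₀ hba] at hk
    nlinarith
  have hL0 : 0 < (N * k : ℚ) := by positivity
  obtain ⟨j, hj⟩ : ∃ j : ℤ, j = ⌊(N * k : ℚ) * a - 1 / (N * k)⌋ + 1 := ⟨_, rfl⟩
  have hj1 : (N * k : ℚ) * a - 1 / (N * k) < j := by
    rw [hj]; push_cast; exact Int.lt_floor_add_one _
  have hj2 : (j : ℚ) ≤ (N * k : ℚ) * a - 1 / (N * k) + 1 := by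
    rw [hj]; push_cast; linarith [Int.floor_le ((N * k : ℚ) * a - 1 / (N * k))]
  -- With `L = N k`, this is a parabolic matrix fixing `j / L`, and `A ∞ = j / L + 1 / L²`. The
  -- choice of `j` puts this in `(a, a + 1 / L]`, and `1 / L < b - a`.
  let A : SL(2, ℤ) := ⟨!![1 + N * k * j, -j ^ 2; (N * k) ^ 2, 1 - N * k * j], by
    rw [Matrix.det_fin_two_of]; ring⟩
  have h00 : A 0 0 = 1 + N * k * j := rfl
  have h10 : A 1 0 = (N * k) ^ 2 := rfl
  refine ⟨toPSL A, ⟨A, ?_, rfl⟩, (A 0 0 : ℚ) / A 1 0, ?_, ?_, ?_⟩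
  · rw [SetLike.mem_coe, CongruenceSubgroup.Gamma0_mem, h10]
    simp
  · rw [toPSL_smul_infty, if_neg]
    rw [h10]
    push_cast
    positivity
  · rw [h00, h10]
    push_cast
    rw [lt_div_iff₀ (by positivity)]
    rw [sub_lt_iff_lt_add] at hj1
    have := mul_lt_mul_of_pos_left hj1 hL0
    rw [mul_add, mul_one_div_cancel hL0.ne'] at this
    linarith
  · rw [h00, h10]
    push_cast
    rw [div_lt_iff₀ (by positivity)]
    have := mul_le_mul_of_nonneg_left hj2 hL0.le
    rw [mul_add, mul_sub, mul_one_div_cancel hL0.ne'] at this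
    nlinarith

/-! ### Bases over the group ring and partial symbols -/

theorem linearIndependent_of_dual {R M ι : Type*} [Ring R] [NoZeroDivisors R] [AddCommGroup M]
    [Module R M] {v : ι → M} (f : ι → M →ₗ[R] R) (h : ∀ i, f i (v i) ≠ 0)
    (h' : ∀ i j, j ≠ i → f i (v j) = 0) : LinearIndependent R v := by
  rw [linearIndependent_iff]
  intro l hl
  ext i
  have h1 := congrArg (f i) hl
  rw [Finsupp.linearCombination_apply, map_finsuppSum, map_zero, Finsupp.sum_eq_single i] at h1
  · rw [map_smul, smul_eq_mul] at h1
    exact (mul_eq_zero.mp h1).resolve_right (h i)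
  · intro j _ hj
    rw [map_smul, h' i j hj, smul_zero]
  · simp

/-- A family whose translates form a `ℤ`-basis is a basis over the group ring. -/
theorem exists_basis_asModule {G M ι : Type*} [Group G] [AddCommGroup M] [Fintype ι]
    (ρ : Representation ℤ G M) (x : ι → M) (b : Module.Basis (G × ι) ℤ M)
    (hb : ∀ g i, b (g, i) = ρ g (x i)) :
    ∃ b' : Module.Basis ι (MonoidAlgebra ℤ G) ρ.asModule, ∀ i, ρ.asModuleEquiv (b' i) = x i := by
  have hsmul : ∀ (f : MonoidAlgebra ℤ G) (i : ι),
      ρ.asModuleEquiv (f • ρ.asModuleEquiv.symm (x i)) = f.coeff.sum fun g n => n • b (g, i) := by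
    intro f i
    rw [Representation.asModuleEquiv_map_smul, LinearEquiv.apply_symm_apply,
      Representation.asAlgebraHom_def, MonoidAlgebra.lift_apply]
    simp only [Finsupp.sum, LinearMap.sum_apply, LinearMap.smul_apply, hb]
  refine ⟨Module.Basis.mk (v := fun i => ρ.asModuleEquiv.symm (x i)) ?_ ?_, fun i => ?_⟩
  · rw [Fintype.linearIndependent_iff]
    intro f hf i
    have h1 := congrArg ρ.asModuleEquiv hf
    rw [map_sum, map_zero] at h1
    simp only [hsmul] at h1
    ext g
    have h2 := congrArg (fun y => b.repr y (g, i)) h1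
    simp only [Finsupp.sum, map_sum, map_smul, Module.Basis.repr_self, map_zero,
      Finsupp.coe_finsetSum, Finset.sum_apply, Finsupp.smul_apply, Finsupp.coe_zero,
      Pi.zero_apply] at h2
    rw [Finset.sum_eq_single i] at h2
    · rw [Finset.sum_eq_single g] at h2
      · simpa using h2
      · intro g' _ hg'
        rw [Finsupp.single_eq_of_ne (by simpa using hg'.symm), smul_zero]
      · intro hg
        rw [Finsupp.notMem_support_iff.mp hg, zero_smul]
    · intro i' _ hi'
      refine Finset.sum_eq_zero fun g' _ => ?_
      rw [Finsupp.single_eq_of_ne (by simp [hi'.symm]), smul_zero]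
    · simp
  · intro y _
    rw [← ρ.asModuleEquiv.symm_apply_apply y, ← b.linearCombination_repr (ρ.asModuleEquiv y),
      Finsupp.linearCombination_apply, Finsupp.sum, map_sum]
    refine sum_mem fun p _ => ?_
    obtain ⟨g, i⟩ := p
    rw [hb, map_smul, Representation.asModuleEquiv_symm_map_rho]
    exact zsmul_mem (Submodule.smul_mem _ _ (Submodule.subset_span (Set.mem_range_self i))) _
  · rw [Module.Basis.mk_apply, LinearEquiv.apply_symm_apply]

/-- Partial modular symbols are determined by their values on representatives of a basis. -/
theorem exists_symb_equiv {Γ Γ' : Subgroup PSL(2, ℤ)} {C : Set P1Q} (hC : IsInvariant Γ' C)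
    (hle : Γ ≤ Γ') {ι J : Type*} (x : ι → degZeroDiv C)
    (b : Module.Basis (Γ' × ι) ℤ (degZeroDiv C)) (hb : ∀ g i, b (g, i) = degZeroRep hC g (x i))
    (r : J → Γ') (hr : ∀ g : Γ', ∃! j, (g : PSL(2, ℤ)) * (r j : PSL(2, ℤ))⁻¹ ∈ Γ)
    (V : Type*) [AddCommGroup V] [DistribMulAction (↥Γ)ᵐᵒᵖ V] :
    ∃ Φ : Symb (hC.mono hle) V ≃+ (J × ι → V), ∀ φ j i, Φ φ (j, i) =
      (φ : degZeroDiv C →+ V) (degZeroRep hC (r j) (x i)) := by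
  have hrep : ∀ (γ : Γ) (y : degZeroDiv C),
      degZeroRep (hC.mono hle) γ y = degZeroRep hC (Subgroup.inclusion hle γ) y := fun _ _ => rfl
  choose j hj huniq using hr
  let Ψ : Symb (hC.mono hle) V →+ (J × ι → V) :=
    { toFun := fun φ p => (φ : degZeroDiv C →+ V) (degZeroRep hC (r p.1) (x p.2))
      map_zero' := rfl
      map_add' := fun _ _ => rfl }
  refine ⟨AddEquiv.ofBijective Ψ ⟨?_, ?_⟩, fun φ j i => rfl⟩
  · rw [injective_iff_map_eq_zero]
    intro φ hφ
    have hlin : (φ : degZeroDiv C →+ V).toIntLinearMap = 0 := by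
      refine b.ext fun p => ?_
      obtain ⟨g, i⟩ := p
      have h1 := φ.2 ⟨_, hj g⟩ (degZeroRep hC (r (j g)) (x i))
      have h2 : (φ : degZeroDiv C →+ V) (degZeroRep hC (r (j g)) (x i)) = 0 :=
        congrFun hφ (j g, i)
      have h3 : Subgroup.inclusion hle ⟨_, hj g⟩ * r (j g) = g :=
        Subtype.ext (inv_mul_cancel_right _ _)
      rw [h2, smul_eq_zero_iff_eq, hrep, ← Module.End.mul_apply, ← map_mul, h3] at h1
      rw [hb]
      exact h1
    ext y
    exact LinearMap.congr_fun hlin y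
  · intro v
    -- Writing `g = δ r_j` with `δ = g r_j⁻¹` in `Γ`, the relation `φ(δ y)|δ = φ(y)` forces the
    -- value `v|δ⁻¹`.
    let φ : degZeroDiv C →ₗ[ℤ] V := b.constr ℤ fun p =>
      MulOpposite.op (⟨_, hj p.1⟩ : Γ)⁻¹ • v (j p.1, p.2)
    have hφ : ∀ g i, φ (degZeroRep hC g (x i)) =
        MulOpposite.op (⟨_, hj g⟩ : Γ)⁻¹ • v (j g, i) := by
      intro g i
      rw [← hb]
      exact b.constr_basis _ _ _
    have hval : ∀ (γ : Γ) (k : J) (i : ι),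
        φ (degZeroRep hC (Subgroup.inclusion hle γ * r k) (x i)) = MulOpposite.op γ⁻¹ • v (k, i) := by
      intro γ k i
      have hk : k = j (Subgroup.inclusion hle γ * r k) := by
        apply huniq
        change (γ : PSL(2, ℤ)) * r k * (r k : PSL(2, ℤ))⁻¹ ∈ Γ
        rw [mul_inv_cancel_right]
        exact γ.2
      rw [hφ]
      congr 3
      · apply Subtype.ext
        change (γ : PSL(2, ℤ)) * r k * (r _ : PSL(2, ℤ))⁻¹ = γ
        rw [← hk, mul_inv_cancel_right]
      · exact hk.symm
    refine ⟨⟨φ.toAddMonoidHom, ?_⟩, ?_⟩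
    · intro γ y
      have : ((DistribSMul.toAddMonoidHom V (MulOpposite.op γ)).comp
          (φ.toAddMonoidHom.comp (degZeroRep (hC.mono hle) γ).toAddMonoidHom)).toIntLinearMap
          = φ := by
        refine b.ext fun p => ?_
        obtain ⟨g, i⟩ := p
        obtain ⟨δ, k, rfl⟩ : ∃ (δ : Γ) (k : J), g = Subgroup.inclusion hle δ * r k :=
          ⟨⟨_, hj g⟩, j g, Subtype.ext (inv_mul_cancel_right _ _).symm⟩
        rw [hb]
        change MulOpposite.op γ • φ (degZeroRep (hC.mono hle) γ _) = _
        rw [hrep, ← Module.End.mul_apply, ← map_mul, ← mul_assoc, ← map_mul, hval, hval,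
          ← mul_smul, ← MulOpposite.op_mul, mul_inv_rev, inv_mul_cancel_right]
      exact LinearMap.congr_fun this y
    · funext p
      obtain ⟨k, i⟩ := p
      have := hval 1 k i
      rw [map_one, one_mul, inv_one, MulOpposite.op_one, one_smul] at this
      exact this

/-! ### The integral basis of translates -/

/-- The number of points of a divisor, counted with multiplicity, that are larger than `c`. -/
def countGreater (c : ℚ) : (P1Q →₀ ℤ) →ₗ[ℤ] ℤ :=
  open Classical in Finsupp.linearCombination ℤ fun v : P1Q => if ∃ w : ℚ, v = w ∧ c < w then 1 else 0

theorem countGreater_pathDiv {c a b : ℚ} {γ : PSL(2, ℤ)} (ha : γ • (∞ : P1Q) = a)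
    (hb : γ • ((0 : ℚ) : P1Q) = b) :
    countGreater c (pathDiv γ) = (if c < a then 1 else 0) - (if c < b then 1 else 0) := by
  rw [pathDiv, map_sub, ha, hb, countGreater, Finsupp.linearCombination_single,
    Finsupp.linearCombination_single]
  simp only [OnePoint.coe_eq_coe, one_smul, exists_eq_left']

theorem pathDiv_mem_degZeroDiv {C : Set P1Q} {γ : PSL(2, ℤ)} (h : γ • (∞ : P1Q) ∈ C)
    (h0 : γ • ((0 : ℚ) : P1Q) ∈ C) : pathDiv γ ∈ degZeroDiv C := by
  refine ⟨?_, ?_⟩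
  · exact sub_mem (Finsupp.single_mem_supported ℤ 1 h) (Finsupp.single_mem_supported ℤ 1 h0)
  · rw [SetLike.mem_coe, LinearMap.mem_ker, pathDiv, map_sub]
    simp

namespace IsBoundaryEnumeration

variable {Γ : Subgroup PSL(2, ℤ)} {F : Set ℍ} {t : ℕ} {e e' : Fin t → PSL(2, ℤ)}

theorem mem_left (he : IsBoundaryEnumeration Γ F e e') (i : Fin t) : e i ∈ orientedBoundary F :=
  he.range_eq ▸ ⟨Sum.inl (Sum.inl i), rfl⟩

theorem mem_right (he : IsBoundaryEnumeration Γ F e e') (i : Fin t) : e' i ∈ orientedBoundary F :=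
  he.range_eq ▸ ⟨Sum.inl (Sum.inr i), rfl⟩

theorem pathInfty_mem (he : IsBoundaryEnumeration Γ F e e') : pathInfty ∈ orientedBoundary F :=
  he.range_eq ▸ ⟨Sum.inr 0, rfl⟩

theorem pathInftyStar_mem (he : IsBoundaryEnumeration Γ F e e') :
    pathInftyStar ∈ orientedBoundary F :=
  he.range_eq ▸ ⟨Sum.inr 1, rfl⟩

theorem finite (he : IsBoundaryEnumeration Γ F e e') : (orientedBoundary F).Finite :=
  he.range_eq ▸ Set.finite_range _

theorem left_injective (he : IsBoundaryEnumeration Γ F e e') : Function.Injective e :=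
  fun i j h => Sum.inl_injective (Sum.inl_injective (@he.injective (Sum.inl (Sum.inl i))
    (Sum.inl (Sum.inl j)) h))

theorem left_ne_right (he : IsBoundaryEnumeration Γ F e e') (i j : Fin t) : e i ≠ e' j := by
  intro h
  have := @he.injective (Sum.inl (Sum.inl i)) (Sum.inl (Sum.inr j)) h
  simp at this

theorem exists_arc (hF : IsUnimodularDomain Γ F) (he : IsBoundaryEnumeration Γ F e e') (i : Fin t) :
    (∃ p q, IsClockwiseArc (e i) p q) ∧ ∃ p q, IsClockwiseArc (e' i) p q := by
  constructor
  · refine hF.exists_isClockwiseArc he.pathInftyStar_mem he.pathInfty_mem (he.mem_left i) ?_ ?_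
    · intro h
      have := @he.injective (Sum.inl (Sum.inl i)) (Sum.inr 1) h
      simp at this
    · intro h
      have := @he.injective (Sum.inl (Sum.inl i)) (Sum.inr 0) h
      simp at this
  · refine hF.exists_isClockwiseArc he.pathInftyStar_mem he.pathInfty_mem (he.mem_right i) ?_ ?_
    · intro h
      have := @he.injective (Sum.inl (Sum.inr i)) (Sum.inr 1) h
      simp at this
    · intro h
      have := @he.injective (Sum.inl (Sum.inr i)) (Sum.inr 0) h
      simp at this

theorem eq_or_eq (he : IsBoundaryEnumeration Γ F e e') {f : PSL(2, ℤ)}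
    (hf : f ∈ orientedBoundary F) :
    (∃ i, f = e i) ∨ (∃ i, f = e' i) ∨ f = pathInfty ∨ f = pathInftyStar := by
  rw [← he.range_eq] at hf
  obtain ⟨(i | i) | i, h⟩ := hf
  · exact Or.inl ⟨i, h.symm⟩
  · exact Or.inr (Or.inl ⟨i, h.symm⟩)
  · fin_cases i
    · exact Or.inr (Or.inr (Or.inl h.symm))
    · exact Or.inr (Or.inr (Or.inr h.symm))

theorem eq_or_eq_of_isClockwiseArc (he : IsBoundaryEnumeration Γ F e e') {f : PSL(2, ℤ)}
    (hf : f ∈ orientedBoundary F) {p q : ℚ} (ha : IsClockwiseArc f p q) :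
    (∃ i, f = e i) ∨ (∃ i, f = e' i) := by
  rcases he.eq_or_eq hf with h | h | rfl | rfl
  · exact Or.inl h
  · exact Or.inr h
  · exfalso
    have h := ha.zero
    rw [pathInfty, map_mul, mul_smul, S_smul_zero, T_smul_infty] at h
    exact OnePoint.infty_ne_coe _ h
  · exfalso
    have h := ha.infty
    rw [pathInftyStar, one_smul] at h
    exact OnePoint.infty_ne_coe _ h

/-- The translates of the boundary arcs `e i` form a `ℤ`-basis of the divisors of degree zero. -/
theorem exists_basis (hF : IsUnimodularDomain Γ F) (hT : toPSL ModularGroup.T ∈ Γ)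
    (hdense : DenseCusps Γ) {C : Set P1Q} (hCmem : ∀ v, v ∈ C ↔ ¬ ∃ g ∈ Γ, g • (∞ : P1Q) = v)
    (hC : IsInvariant Γ C) (he : IsBoundaryEnumeration Γ F e e') :
    ∃ (x : Fin t → degZeroDiv C) (b : Module.Basis (Γ × Fin t) ℤ (degZeroDiv C)),
      (∀ i, (x i : P1Q →₀ ℤ) = pathDiv (e i)) ∧ ∀ g i, b (g, i) = degZeroRep hC g (x i) := by
  have h1 := he.pathInftyStar_mem
  have hI := he.pathInfty_mem
  have hend : ∀ i, e i • (∞ : P1Q) ∈ C ∧ e i • ((0 : ℚ) : P1Q) ∈ C := by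
    intro i
    obtain ⟨p, q, ha⟩ := (he.exists_arc hF i).1
    rw [hCmem, hCmem, ha.zero, ha.infty]
    exact ⟨fun ⟨g, hg, h⟩ => (hF.smul_notMem_orbit h1 hT (he.mem_left i) ha hg).2 h.symm,
      fun ⟨g, hg, h⟩ => (hF.smul_notMem_orbit h1 hT (he.mem_left i) ha hg).1 h.symm⟩
  let x : Fin t → degZeroDiv C := fun i => ⟨pathDiv (e i), pathDiv_mem_degZeroDiv (hend i).1 (hend i).2⟩
  let v : Γ × Fin t → degZeroDiv C := fun p => degZeroRep hC p.1 (x p.2)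
  have hv : ∀ p, (v p : P1Q →₀ ℤ) = pathDiv (p.1 * e p.2) := fun p => divRep_pathDiv _ _
  have hcoe : ∀ c ∈ C, ∃ w : ℚ, c = w := fun c hc =>
    exists_coe_of_ne_infty fun h => (hCmem c).mp hc ⟨1, one_mem _, by rw [one_smul, h]⟩
  have hli : LinearIndependent ℤ v := by
    choose g hg hrev using he.reverse_eq
    choose p q ha using fun i => (he.exists_arc hF i).1
    choose p' q' ha' using fun i => (he.exists_arc hF i).2
    choose c hc hqc hcp using fun i =>
      IsUnimodularDomain.exists_smul_infty_of_pathReverse_eq (ha i) (ha' i) (hrev i)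
    -- The functional of `(γ, i)` moves a divisor back by `γ⁻¹` and counts its points beyond `c i`.
    -- It gives `-1` on `γ e_i` and vanishes on a path whose moved ends are on the same side of `c
    -- i`.
    refine linearIndependent_of_dual (fun k => countGreater (c k.2) ∘ₗ
      (divRep (k.1 : PSL(2, ℤ))⁻¹) ∘ₗ (degZeroDiv C).subtype) ?_ ?_
    · rintro ⟨γ, i⟩
      change countGreater (c i) (divRep (γ : PSL(2, ℤ))⁻¹ (v (γ, i))) ≠ 0
      rw [hv, divRep_pathDiv, inv_mul_cancel_left, countGreater_pathDiv (ha i).infty (ha i).zero,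
        if_neg (not_lt.mpr (hqc i).le), if_pos (hcp i)]
      norm_num
    · rintro ⟨γ, i⟩ ⟨δ, j⟩ hne
      change countGreater (c i) (divRep (γ : PSL(2, ℤ))⁻¹ (v (δ, j))) = 0
      have hmem : (γ : PSL(2, ℤ))⁻¹ * δ ∈ Γ := mul_mem (inv_mem γ.2) δ.2
      rw [hv, divRep_pathDiv, ← mul_assoc]
      have hA := hC _ hmem _ (hend j).1
      have hB := hC _ hmem _ (hend j).2
      rw [← mul_smul] at hA hB
      obtain ⟨a, hAa⟩ := hcoe _ hA
      obtain ⟨b, hBb⟩ := hcoe _ hB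
      rw [hAa] at hA
      rw [hBb] at hB
      have hac : a ≠ c i := fun h => (hCmem _).mp hA ⟨g i, hg i, by rw [hc, h]⟩
      have hbc : b ≠ c i := fun h => (hCmem _).mp hB ⟨g i, hg i, by rw [hc, h]⟩
      rw [countGreater_pathDiv hAa hBb]
      -- A path separating `c i` from `∞` would be `e i` itself, excluded by `hne`, or have `e j =
      -- e' i`, excluded because the enumeration has no repetition.
      have hsep : ¬ (c i - a) * (c i - b) < 0 := by
        intro hsep
        rcases hF.eq_or_eq_of_separated h1 hI (he.mem_left i) (he.mem_right i) (he.mem_left j)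
          (ha i) (ha' i) (hg i) hmem (hrev i) (hc i) hBb hAa hsep with ⟨h2, h3⟩ | ⟨-, h3⟩
        · apply hne
          rw [he.left_injective h3, ← Subtype.ext (inv_mul_eq_one.mp h2)]
        · exact he.left_ne_right _ _ h3
      rcases lt_or_gt_of_ne hac with h2 | h2 <;> rcases lt_or_gt_of_ne hbc with h3 | h3
      · rw [if_neg h2.not_gt, if_neg h3.not_gt, sub_self]
      · exact absurd (mul_neg_of_pos_of_neg (by linarith) (by linarith)) hsep
      · exact absurd (mul_neg_of_neg_of_pos (by linarith) (by linarith)) hsep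
      · rw [if_pos h2, if_pos h3, sub_self]
  have hspan : ⊤ ≤ Submodule.span ℤ (Set.range v) := by
    let D : Submodule ℤ (P1Q →₀ ℤ) := (Submodule.span ℤ (Set.range v)).map (degZeroDiv C).subtype
    have hDeq : D = Submodule.span ℤ (Set.range fun p : Γ × Fin t => pathDiv (p.1 * e p.2)) := by
      change Submodule.map _ _ = _
      rw [Submodule.map_span, ← Set.range_comp]
      congr 2
      funext p
      exact hv p
    have hDΓ : ∀ γ ∈ Γ, ∀ y ∈ D, divRep γ y ∈ D := by
      intro γ hγ y hy
      rw [hDeq] at hy ⊢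
      induction hy using Submodule.span_induction with
      | mem y hy =>
        obtain ⟨p, rfl⟩ := hy
        exact Submodule.subset_span ⟨(⟨γ, hγ⟩ * p.1, p.2), by
          dsimp only
          rw [divRep_pathDiv, ← mul_assoc]; rfl⟩
      | zero => rw [map_zero]; exact zero_mem _
      | add y z _ _ h1 h2 => rw [map_add]; exact add_mem h1 h2
      | smul n y _ h => rw [map_smul]; exact Submodule.smul_mem _ _ h
    have hDe : ∀ i, pathDiv (e i) ∈ D := by
      intro i
      rw [hDeq]
      exact Submodule.subset_span ⟨(1, i), by simp⟩
    -- The arcs `e' i` are obtained from `e i` by reversal and a translation by `Γ`.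
    have hD : ∀ f ∈ orientedBoundary F, ∀ p q : ℚ, IsClockwiseArc f p q → pathDiv f ∈ D := by
      intro f hf p q ha
      rcases he.eq_or_eq_of_isClockwiseArc hf ha with ⟨i, rfl⟩ | ⟨i, rfl⟩
      · exact hDe i
      · obtain ⟨g, hg, hr⟩ := he.reverse_eq i
        have h := hDΓ _ (inv_mem hg) _ (neg_mem (hDe i))
        rwa [← pathDiv_pathReverse, divRep_pathDiv, hr, inv_mul_cancel_left] at h
    rintro ⟨y, hy, hy0⟩ -
    have hyD : y ∈ D := by
      rcases C.eq_empty_or_nonempty with hemp | ⟨u, hu⟩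
      · subst hemp
        have : y = 0 := by simpa [Finsupp.supported_empty] using hy
        rw [this]
        exact zero_mem D
      · have hdeg : (y.sum fun _ n => n) = 0 := by
          rw [SetLike.mem_coe, LinearMap.mem_ker, Finsupp.linearCombination_apply] at hy0
          simpa using hy0
        -- Since the degree is zero, subtracting a base cusp `u` in `C` from each point changes
        -- nothing.
        have hsum : y = y.sum fun w n => n • (Finsupp.single w (1 : ℤ) - Finsupp.single u 1) := by
          simp only [smul_sub, Finsupp.sum_sub, Finsupp.smul_single, smul_eq_mul, mul_one,
            Finsupp.sum_single]
          have : (y.sum fun _ n => Finsupp.single u n) = Finsupp.single u (y.sum fun _ n => n) := by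
            rw [Finsupp.sum, Finsupp.sum, Finsupp.single_finsetSum]
          rw [this, hdeg, Finsupp.single_zero, sub_zero]
        rw [hsum]
        refine sum_mem fun w hw => zsmul_mem ?_ _
        exact hF.single_sub_single_mem h1 hI hT he.finite hdense hD hDΓ
          ((hCmem w).mp (hy hw)) ((hCmem u).mp hu)
    obtain ⟨y', hy', hyy'⟩ := hyD
    have : y' = ⟨y, hy, hy0⟩ := Subtype.ext hyy'
    rwa [← this]
  refine ⟨x, Module.Basis.mk hli hspan, fun i => rfl, fun g i => ?_⟩
  rw [Module.Basis.mk_apply]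

end IsBoundaryEnumeration

theorem mem_cuspsAway {N : ℕ} (v : P1Q) :
    v ∈ cuspsAway N ↔ ¬ ∃ g ∈ PGamma0 N, g • (∞ : P1Q) = v := by
  rw [cuspsAway, Set.mem_compl_iff, MulAction.mem_orbit_iff]
  exact not_congr ⟨fun ⟨g, h⟩ => ⟨g, g.2, h⟩, fun ⟨g, hg, h⟩ => ⟨⟨g, hg⟩, h⟩⟩

end PartialSymbols

end

theorem proposition2p9 (l : ℕ) (hl : l.Prime) (hmod : l % 12 = 11) (F : Set ℍ)
    (hF : PartialSymbols.IsUnimodularDomain (PartialSymbols.PGamma0 (l ^ 2)) F)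
    (t : ℕ) (e e' : Fin t → PSL(2, ℤ))
    (he : PartialSymbols.IsBoundaryEnumeration (PartialSymbols.PGamma0 (l ^ 2)) F e e') :
    ∃ b : Module.Basis (Fin t) (MonoidAlgebra ℤ (PartialSymbols.PGamma0 (l ^ 2)))
        (PartialSymbols.degZeroRep
          (PartialSymbols.isInvariant_cuspsAway (l ^ 2))).asModule,
      (∀ i, ((Representation.asModuleEquiv _ (b i) :
          PartialSymbols.degZeroDiv (PartialSymbols.cuspsAway (l ^ 2))) :
          PartialSymbols.P1Q →₀ ℤ) = PartialSymbols.pathDiv (e i)) ∧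
      ∀ (p m : ℕ) (_ : p.Prime) (_ : l ≠ p) (_ : 1 ≤ m)
        (Γ : Subgroup PSL(2, ℤ)) (_ : Γ.FiniteIndex)
        (hΓ : Γ ≤ PartialSymbols.PGamma0 (l ^ 2 * p ^ m))
        (r : Fin (Γ.relIndex (PartialSymbols.PGamma0 (l ^ 2))) → PartialSymbols.PGamma0 (l ^ 2))
        (_ : ∀ g : PartialSymbols.PGamma0 (l ^ 2), ∃! j, (g : PSL(2, ℤ)) * (r j : PSL(2, ℤ))⁻¹ ∈ Γ)
        (V : Type*) [AddCommGroup V] [DistribMulAction (↥Γ)ᵐᵒᵖ V],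
        ∃ Φ : PartialSymbols.Symb
              ((PartialSymbols.isInvariant_cuspsAway (l ^ 2)).mono
                (hΓ.trans (PartialSymbols.PGamma0_mul_le (l ^ 2) (p ^ m)))) V ≃+
            (Fin (Γ.relIndex (PartialSymbols.PGamma0 (l ^ 2))) × Fin t → V),
          ∀ φ j i, Φ φ (j, i) =
            (φ : PartialSymbols.degZeroDiv (PartialSymbols.cuspsAway (l ^ 2)) →+ V)
              (PartialSymbols.degZeroRep (PartialSymbols.isInvariant_cuspsAway (l ^ 2)) (r j)
                (Representation.asModuleEquiv _ (b i))) := by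
  have hN : l ^ 2 ≠ 0 := pow_ne_zero _ hl.ne_zero
  obtain ⟨x, b, hx, hb⟩ := PartialSymbols.IsBoundaryEnumeration.exists_basis hF
    (PartialSymbols.T_mem_PGamma0 _) (PartialSymbols.denseCusps_PGamma0 hN)
    PartialSymbols.mem_cuspsAway (PartialSymbols.isInvariant_cuspsAway (l ^ 2)) he
  obtain ⟨b', hb'⟩ := PartialSymbols.exists_basis_asModule _ x b hb
  refine ⟨b', fun i => by rw [hb', hx], ?_⟩
  intro p m _ _ _ Γ _ hΓ r hr V _ _
  simp only [hb']
  exact PartialSymbols.exists_symb_equiv (PartialSymbols.isInvariant_cuspsAway (l ^ 2))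
    (hΓ.trans (PartialSymbols.PGamma0_mul_le (l ^ 2) (p ^ m))) x b hb r hr V
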